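/- **Setting.** Let $d\ge 3$. Let $P_x$ be the law of simple random walk $(X_n)_{n\ge 0}$ on $\mathbb Z^d$ started at $x$, let $g(x,y)=\sum_{n\ge 0}P_x[X_n=y]$ be its Green function, and let $Gf(x)=\sum_{y}g(x,y)f(y)$. For a finite set $K\subset\mathbb Z^d$ let $e_K(x)=P_x[X_n\notin K\ \text{for all } n\ge 1]\,1_K(x)$ be its equilibrium measure. For a finitely supported function $V$, $GV$ denotes the composition of $G$ with multiplication by $V$, acting on $L^\infty(\mathbb Z^d)$, and $(f,h)=\sum_x f(x)h(x)$. Let $\widehat W$ be the space of doubly infinite sequences $\widehat w=(X_n,\sigma_n)_{n\in\mathbb Z}$ in $\mathbb Z^d\times(0,\infty)$ such that $(X_n)$ is a nearest neighbour trajectory visiting each site finitely often and the forward and backward sums of the $\sigma_n$ are infinite. Let $\pi^*:\widehat W\to\widehat W^*$ be the quotient by time-shift, $\widehat W^*$ being endowed with the quotient of the canonical $\sigma$-algebra. For finite $K$ let $\widehat Q_K$ be the finite measure on $\widehat W$ with $\widehat Q_K(X_0=x)=e_K(x)$ under which, when $e_K(x)>0$, conditionally on $X_0=x$, the sequences $(X_n)_{n\ge0}$,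 $(X_{-n})_{n\ge0}$, $(\sigma_n)_{n\in\mathbb Z}$ are independent and distributed respectively as simple random walk from $x$, as simple random walk from $x$ conditioned never to return to $K$ (at times $n\ge1$), and as i.i.d. exponential variables of parameter $1$. Let $\widehat\nu$ be the $\sigma$-finite measure on $\widehat W^*$ whose restriction to the set of trajectories entering $K$ is $\pi^*\circ\widehat Q_K$ (the image of $\widehat Q_K$ under $\pi^*$), for every finite $K$. The continuous time random interlacement is a Poisson point process $\omega=\sum_{i\ge0}\delta_{(\widehat w_i^*,u_i)}$ on $\widehat W^*\times\mathbb R_+$ with intensity $\widehat\nu(d\widehat w^*)\,du$, and its occupation times are $$L_{x,u}(\omega)=\sum_{i\ge0}\sum_{n\in\mathbb Z}\sigma_n(\widehat w_i)\,1\{X_n(\widehat w_i)=x,\ u_i\le u\},\qquad x\in\mathbb Z^d,\ u\ge0,$$ where $\pi^*(\widehat w_i)=\widehat w_i^*$. **Theorem 2.1.** Let $K\subset\mathbb Z^d$ be finite. (a) There is a constant $c(K)>0$ (depending only on $d$ and $K$) such that for every function $V:\mathbb Z^d\to\mathbb C$ (in particular every real-valued one) with support in $K$ and $\|V\|_\infty\le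 c(K)$, the operator $GV$ is a bounded operator on $L^\infty(\mathbb Z^d)$ with $$\|GV\|_{L^\infty\to L^\infty}<1,$$ and for every $u\ge0$ the variables $L_{x,u}$ are almost surely finite, $\exp\{\sum_x V(x)L_{x,u}\}$ is integrable, and $$\mathbb E\Bigl[\exp\Bigl\{\sum_{x\in\mathbb Z^d}V(x)L_{x,u}\Bigr\}\Bigr]=\exp\bigl\{u\,\bigl(V,(I-GV)^{-1}1\bigr)\bigr\}.$$ (b) Consequently, for every real-valued $V$ with support in $K$, the characteristic function of $\sum_x V(x)L_{x,u}$ is near $0$ the exponential of an analytic function: there are a function $F$, analytic in a neighbourhood of $0$ in $\mathbb C$, and $r>0$, such that for all $u\ge0$ and all real $t$ with $|t|<r$, $$\mathbb E\Bigl[\exp\Bigl\{it\sum_{x\in\mathbb Z^d}V(x)L_{x,u}\Bigr\}\Bigr]=\exp\{u\,F(t)\}.$$ -/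

import Mathlib

open MeasureTheory ProbabilityTheory Filter Topology
open scoped ENNReal

noncomputable section

namespace Interlacement

/-- The lattice of integer points in dimension `d`. -/
abbrev Site (d : ℕ) : Type := Fin d → ℤ

/-- The `ℓ¹` norm on the lattice; two sites are nearest neighbours when it is `1` on their
difference. -/
def l1 {d : ℕ} (x : Site d) : ℤ := ∑ i, |x i|

/-! ### Simple random walk, Green function, equilibrium measure -/

/-- The law of a step of simple random walk: uniform on the `2 d` neighbours of the origin. -/
def stepLaw (d : ℕ) : Measure (Site d) := uniformOn {e : Site d | l1 e = 1}

/-- The law on trajectories `ℕ → ℤ^d` of simple random walk started at `x`, that is, the law of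
`n ↦ x + ξ 0 + ⋯ + ξ (n - 1)` with i.i.d. steps `ξ i`. -/
def walkLaw {d : ℕ} (x : Site d) : Measure (ℕ → Site d) :=
  (Measure.infinitePi fun _ : ℕ => stepLaw d).map fun ξ n => x + ∑ i ∈ Finset.range n, ξ i

/-- The Green function `g(x, y) = ∑ₙ P_x[X_n = y]`. -/
def green {d : ℕ} (x y : Site d) : ℝ≥0∞ := ∑' n : ℕ, walkLaw x {w | w n = y}

/-- The trajectories that do not visit `K` at any time `n ≥ 1`. -/
def noReturn {d : ℕ} (K : Finset (Site d)) : Set (ℕ → Site d) := {w | ∀ n, 1 ≤ n → w n ∉ K}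

/-- The density of the equilibrium measure of `K`. -/
def equilibrium {d : ℕ} (K : Finset (Site d)) (x : Site d) : ℝ≥0∞ :=
  if x ∈ K then walkLaw x (noReturn K) else 0

/-- The operator `G f (x) = ∑_y g(x, y) f(y)`. -/
def greenOp {d : ℕ} (f : Site d → ℂ) (x : Site d) : ℂ := ∑' y, ((green x y).toReal : ℂ) * f y

/-- The bilinear pairing `(f, h) = ∑_x f(x) h(x)`. -/
def pairing {d : ℕ} (f h : Site d → ℂ) : ℂ := ∑' x, f x * h x

/-! ### Doubly infinite trajectories with holding times -/

/-- Doubly infinite nearest neighbour trajectories visiting each site finitely many times (hence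
spending finite time in finite sets), with positive holding times that have infinite forward and
backward sums. -/
structure IsTrajectory {d : ℕ} (w : ℤ → Site d × ℝ) : Prop where
  nearest : ∀ n, l1 ((w (n + 1)).1 - (w n).1) = 1
  transient : ∀ y, {n | (w n).1 = y}.Finite
  pos : ∀ n, 0 < (w n).2
  forward : ∑' n : ℕ, ENNReal.ofReal (w (n : ℤ)).2 = ∞
  backward : ∑' n : ℕ, ENNReal.ofReal (w (-(n : ℤ))).2 = ∞

/-- The space of doubly infinite trajectories, with its canonical (product) sigma-algebra. -/
abbrev Traj (d : ℕ) : Type := {w : ℤ → Site d × ℝ // IsTrajectory w}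

/-- Equality up to time-shift. -/
def shiftSetoid (d : ℕ) : Setoid (Traj d) where
  r w w' := ∃ k : ℤ, ∀ n, w.1 n = w'.1 (n + k)
  iseqv :=
    { refl := fun _ => ⟨0, fun n => by rw [add_zero]⟩
      symm := fun {w w'} ⟨k, hk⟩ => ⟨-k, fun n => by rw [hk (n + -k), neg_add_cancel_right]⟩
      trans := fun {w w' w''} ⟨k, hk⟩ ⟨l, hl⟩ =>
        ⟨k + l, fun n => by rw [hk n, hl (n + k), add_assoc]⟩ }

/-- Trajectories modulo time-shift. A set is measurable when its preimage in `Traj d` is. -/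
abbrev TrajMod (d : ℕ) : Type := Quotient (shiftSetoid d)

/-- The canonical projection. -/
def proj {d : ℕ} (w : Traj d) : TrajMod d := Quotient.mk (shiftSetoid d) w

/-- The trajectories modulo time-shift that enter `K`. -/
def entering {d : ℕ} (K : Finset (Site d)) : Set (TrajMod d) :=
  proj '' {w : Traj d | ∃ n, (w.1 n).1 ∈ K}

/-- Glue a forward path, a backward path and a sequence of holding times. -/
def glue {d : ℕ} (p : ((ℕ → Site d) × (ℕ → Site d)) × (ℤ → ℝ)) (n : ℤ) : Site d × ℝ :=
  (if 0 ≤ n then p.1.1 n.toNat else p.1.2 (-n).toNat, p.2 n)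

/-- The measure `Q_K`: `X_0 = x` has mass `e_K(x)`; given `X_0 = x`, the forward path is a simple
random walk from `x`, the backward path is a simple random walk from `x` conditioned never to
return to `K`, the holding times are i.i.d. exponential with parameter `1`, and these three are
independent. The right-hand side is carried by the measurable set of trajectories. -/
def entranceMeasure {d : ℕ} (K : Finset (Site d)) : Measure (Traj d) :=
  (∑ x ∈ K, equilibrium K x •
    (((walkLaw x).prod ((walkLaw x)[|noReturn K])).prod
      (Measure.infinitePi fun _ : ℤ => expMeasure 1)).map glue).comap Subtype.val

/-- The defining property of the intensity measure `ν` of random interlacements: it is sigma-finite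
and, for each finite `K`, its restriction to the trajectories that enter `K` is the image of `Q_K`
under the canonical projection. -/
structure IsIntensity {d : ℕ} (ν : Measure (TrajMod d)) : Prop where
  sigmaFinite : SigmaFinite ν
  restrict_eq : ∀ K : Finset (Site d), ν.restrict (entering K) = (entranceMeasure K).map proj

/-! ### Poisson point processes and random interlacements -/

/-- `N` is a Poisson point process (Poisson random measure) with intensity `m` under `P`. -/
structure IsPoisson {Ω E : Type*} [MeasurableSpace Ω] [MeasurableSpace E]
    (P : Measure Ω) (N : Ω → Measure E) (m : Measure E) : Prop where
  measurable : Measurable N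
  law : ∀ A, MeasurableSet A → m A ≠ ∞ →
    P.map (fun ω => N ω A) = (poissonMeasure (m A).toNNReal).map (Nat.cast : ℕ → ℝ≥0∞)
  indep : ∀ (n : ℕ) (A : Fin n → Set E), (∀ i, MeasurableSet (A i)) →
    Pairwise (Function.onFun Disjoint A) → iIndepFun (fun i ω => N ω (A i)) P

/-- The points `pts ω i = (w_i, u_i)`, `i ≥ 0`, form the continuous time interlacement point process
under `P`: the point measure `∑ i, δ_(w_i, u_i)` is Poisson with intensity `ν(dw) du`, `u ≥ 0`. -/
def IsInterlacement {d : ℕ} {Ω : Type*} [MeasurableSpace Ω] (P : Measure Ω)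
    (pts : Ω → ℕ → TrajMod d × ℝ) : Prop :=
  ∃ ν : Measure (TrajMod d), IsIntensity ν ∧
    IsPoisson P (fun ω => Measure.sum fun i => Measure.dirac (pts ω i))
      (ν.prod (volume.restrict (Set.Ici (0 : ℝ))))

/-- The total time spent at `x` by a trajectory modulo time-shift. -/
def timeAt {d : ℕ} (x : Site d) : TrajMod d → ℝ≥0∞ :=
  Quotient.lift (fun w : Traj d => ∑' n : ℤ, if (w.1 n).1 = x then ENNReal.ofReal (w.1 n).2 else 0)
    (by
      rintro w w' ⟨k, hk⟩
      simp only [hk]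
      exact (Equiv.addRight k).tsum_eq
        (fun n : ℤ => if (w'.1 n).1 = x then ENNReal.ofReal (w'.1 n).2 else 0))

/-- The occupation time `L_{x,u}`: the total time spent at `x` by the trajectories with label at
most `u`. -/
def occTime {d : ℕ} (p : ℕ → TrajMod d × ℝ) (x : Site d) (u : ℝ) : ℝ≥0∞ :=
  ∑' i, if (p i).2 ≤ u then timeAt x (p i).1 else 0

/-- The space `L^∞(ℤ^d)` of bounded functions with the sup-norm. -/
abbrev Linf (d : ℕ) : Type := lp (fun _ : Site d => ℂ) ∞

end Interlacement

end

open MeasureTheory ProbabilityTheory Filter Topology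
open scoped ENNReal

noncomputable section

namespace Interlacement

/-! Only trajectories entering `K` with label at most `u` contribute to `∑ V(x) L_{x,u}`, and these
carry finite intensity. The exponential formula for Poisson processes (`exponential_formula`,
specialised in `occTime_exponential_formula`) therefore gives the Laplace functional as the
exponential of `u` times `∫ (exp(∑ V(y) timeAt y) - 1) dν` over `entering K`.

Under `Q_K` the backward path avoids `K` at negative times, so all the time in `K` is spent by the
forward simple random walk (`totalTime_glue`). The integral becomes `∑ e_K(x) (φ(x) - 1)`, where
`φ(x)` is the expectation of `exp(∑ V(X_k) σ_k)` for the walk started at `x` (`integral_expTimes`).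
Averaging over the exponential holding times turns each factor into `(1 - V(X_k))⁻¹`. The one-step
Markov property, iterated and passed to the limit, then yields `φ = 1 + GVφ` (`fk_eq`,
`feynman_kac`). Hence `φ = (I - GV)⁻¹ 1` as soon as `GV` is a contraction, and the last-exit
identity `e_K G = 1` on `K` reduces `∑ e_K (φ - 1) = ∑ e_K GVφ` to `(V, φ)`
(`exists_feynman_kac_integral`).

Dimension enters through the boundedness of `g(·, y)` (`exists_green_le`), obtained from an explicit
strictly superharmonic function. This gives transience, and it gives a `c` with `‖GV‖ ≤ 1/2` for
every `V` on `K` bounded by `c`. Complex potentials are controlled by domination: the positive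
potential `c` on `K` has a finite exponential moment, by Fatou and a uniform bound, and it dominates
all the others.

For the characteristic function, `i V` is scaled to a small potential `W`. The formula at `z W`
involves only the resolvent `(I - z GW)⁻¹`, which is analytic at `z = 0`. -/

/-! ### Steps of the walk -/

/-- The neighbours of the origin. -/
def nbrs (d : ℕ) : Finset (Site d) :=
  Finset.univ.image fun p : Fin d × Bool => Pi.single p.1 (if p.2 then 1 else -1)

lemma single_sign_injective (d : ℕ) : Function.Injective
    (fun p : Fin d × Bool => (Pi.single p.1 (if p.2 then 1 else -1) : Site d)) := by
  rintro ⟨i, a⟩ ⟨j, b⟩ h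
  have hi := congrFun h i
  have hij : i = j := by
    by_contra hne
    cases a <;> simp [hne] at hi
  subst hij
  cases a <;> cases b <;> simp at hi ⊢

lemma sum_nbrs {d : ℕ} {M : Type*} [AddCommMonoid M] (f : Site d → M) :
    ∑ e ∈ nbrs d, f e = ∑ i, (f (Pi.single i 1) + f (Pi.single i (-1))) := by
  rw [nbrs, Finset.sum_image (fun p _ q _ h => single_sign_injective d h), Fintype.sum_prod_type]
  simp

lemma card_nbrs (d : ℕ) : (nbrs d).card = 2 * d := by
  rw [nbrs, Finset.card_image_of_injective _ (single_sign_injective d)]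
  simp [mul_comm]

lemma mem_nbrs {d : ℕ} {e : Site d} : e ∈ nbrs d ↔ l1 e = 1 := by
  constructor
  · intro h
    obtain ⟨⟨i, b⟩, -, rfl⟩ := Finset.mem_image.1 h
    have : ∀ j, |(Pi.single i (if b then 1 else -1) : Site d) j| = if j = i then 1 else 0 := by
      intro j
      rcases eq_or_ne j i with rfl | hj
      · cases b <;> simp
      · simp [hj]
    simp only [l1, this]
    simp
  · intro h
    have hne : ∃ i, e i ≠ 0 := by
      by_contra! h0
      simp [l1, h0] at h
    obtain ⟨i, hi⟩ := hne
    have hsum : |e i| + ∑ j ∈ Finset.univ.erase i, |e j| = 1 := by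
      rw [Finset.add_sum_erase _ (fun j => |e j|) (Finset.mem_univ i)]
      exact h
    have h0 : 0 ≤ ∑ j ∈ Finset.univ.erase i, |e j| := Finset.sum_nonneg fun _ _ => abs_nonneg _
    have h1 : 0 < |e i| := abs_pos.2 hi
    have h2 : ∑ j ∈ Finset.univ.erase i, |e j| = 0 := by omega
    have h3 : |e i| = 1 := by omega
    have h4 : ∀ j, j ≠ i → e j = 0 := fun j hj => abs_eq_zero.1
      ((Finset.sum_eq_zero_iff_of_nonneg (fun _ _ => abs_nonneg _)).1 h2 j (by simp [hj]))
    have h5 : e = Pi.single i (e i) := by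
      ext j
      rcases eq_or_ne j i with rfl | hj
      · simp
      · simp [hj, h4 j hj]
    rcases (abs_eq (by norm_num : (0 : ℤ) ≤ 1)).1 h3 with h6 | h6
    · exact Finset.mem_image.2 ⟨(i, true), Finset.mem_univ _, by rw [h5, h6]; simp⟩
    · exact Finset.mem_image.2 ⟨(i, false), Finset.mem_univ _, by rw [h5, h6]; simp⟩

lemma coe_nbrs (d : ℕ) : {e : Site d | l1 e = 1} = (nbrs d : Set (Site d)) := by
  ext e
  simp [mem_nbrs]

lemma nbrs_nonempty {d : ℕ} (hd : 0 < d) : (nbrs d).Nonempty := by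
  rw [← Finset.card_pos, card_nbrs]
  omega

lemma isProbabilityMeasure_stepLaw {d : ℕ} (hd : 0 < d) : IsProbabilityMeasure (stepLaw d) := by
  rw [stepLaw, coe_nbrs]
  exact isProbabilityMeasure_uniformOn (nbrs d).finite_toSet (by simpa using nbrs_nonempty hd)

lemma lintegral_stepLaw {d : ℕ} (f : Site d → ℝ≥0∞) :
    ∫⁻ e, f e ∂stepLaw d = (2 * d : ℝ≥0∞)⁻¹ * ∑ e ∈ nbrs d, f e := by
  rw [stepLaw, coe_nbrs, uniformOn, ProbabilityTheory.cond, lintegral_smul_measure, Measure.count_apply_finset,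
    card_nbrs, lintegral_finset]
  simp

/-! ### The walk -/

/-- The trajectory that starts at `x` and then follows `w`. -/
def prepend {α : Type*} (x : α) (w : ℕ → α) : ℕ → α
  | 0 => x
  | n + 1 => w n

@[simp] lemma prepend_zero {α : Type*} (x : α) (w : ℕ → α) : prepend x w 0 = x := rfl

@[simp] lemma prepend_succ {α : Type*} (x : α) (w : ℕ → α) (n : ℕ) :
    prepend x w (n + 1) = w n := rfl

lemma measurable_prepend_uncurry {α : Type*} [MeasurableSpace α] :
    Measurable fun p : α × (ℕ → α) => prepend p.1 p.2 := by
  refine measurable_pi_lambda _ fun n => ?_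
  cases n with
  | zero => exact measurable_fst
  | succ n => exact (measurable_pi_apply n).comp measurable_snd

lemma measurable_prepend {α : Type*} [MeasurableSpace α] (x : α) :
    Measurable (prepend x : (ℕ → α) → ℕ → α) :=
  measurable_prepend_uncurry.comp measurable_prodMk_left

/-- An i.i.d. sequence stays i.i.d. when a fresh independent first term is added. All Markov
properties below come from this. -/
lemma map_prepend_prod_infinitePi {α : Type*} [MeasurableSpace α] (μ : Measure α)
    [IsProbabilityMeasure μ] :
    (μ.prod (Measure.infinitePi fun _ : ℕ => μ)).map (fun p => prepend p.1 p.2) =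
      Measure.infinitePi fun _ : ℕ => μ := by
  refine Measure.eq_infinitePi _ fun s t ht => ?_
  rw [Measure.map_apply measurable_prepend_uncurry
    (MeasurableSet.pi s.countable_toSet fun i _ => ht i)]
  classical
  set t' : ℕ → Set α := fun i => if i ∈ s then t i else Set.univ with ht'
  have ht'm : ∀ i, MeasurableSet (t' i) := by
    intro i
    simp only [ht']
    split_ifs
    · exact ht i
    · exact MeasurableSet.univ
  obtain ⟨n, hn⟩ : ∃ n, s ⊆ Finset.range (n + 1) :=
    ⟨s.sup id, fun i hi => Finset.mem_range.2 (Nat.lt_succ_of_le (Finset.le_sup (f := id) hi))⟩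
  have h1 : (fun p : α × (ℕ → α) => prepend p.1 p.2) ⁻¹' (Set.pi s t) =
      (t' 0) ×ˢ (Set.pi (Finset.range n : Set ℕ) fun i => t' (i + 1)) := by
    ext ⟨a, w⟩
    simp only [Set.mem_preimage, Set.mem_pi, Set.mem_prod, ht', Finset.mem_coe, Finset.mem_range]
    constructor
    · intro h
      refine ⟨?_, fun i _ => ?_⟩
      · split_ifs with h0
        · exact h 0 h0
        · trivial
      · split_ifs with h0
        · exact h _ h0
        · trivial
    · rintro ⟨h0, h⟩ i hi
      cases i with
      | zero => simpa [hi] using h0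
      | succ i =>
        have := Finset.mem_range.1 (hn hi)
        simpa [hi] using h i (by omega)
  rw [h1, Measure.prod_prod, Measure.infinitePi_pi _ (fun i _ => ht'm (i + 1)), mul_comm,
    ← Finset.prod_range_succ' (fun i => μ (t' i)), ← Finset.prod_subset hn]
  · exact Finset.prod_congr rfl fun i hi => by simp [ht', hi]
  · intro i _ hi
    simp [ht', hi]

lemma measurable_walk {d : ℕ} (x : Site d) :
    Measurable fun (ξ : ℕ → Site d) n => x + ∑ i ∈ Finset.range n, ξ i := by
  fun_prop

lemma isProbabilityMeasure_walkLaw {d : ℕ} (hd : 0 < d) (x : Site d) :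
    IsProbabilityMeasure (walkLaw x) := by
  have := isProbabilityMeasure_stepLaw hd
  exact Measure.isProbabilityMeasure_map (measurable_walk x).aemeasurable

/-- The Markov property at time one. -/
lemma walkLaw_eq {d : ℕ} (hd : 0 < d) (x : Site d) :
    walkLaw x = (2 * d : ℝ≥0∞)⁻¹ • ∑ e ∈ nbrs d, (walkLaw (x + e)).map (prepend x) := by
  have := isProbabilityMeasure_stepLaw hd
  ext A hA
  have hA' := measurable_prepend x hA
  rw [walkLaw, ← map_prepend_prod_infinitePi (stepLaw d),
    Measure.map_map (measurable_walk x) measurable_prepend_uncurry,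
    Measure.map_apply ((measurable_walk x).comp measurable_prepend_uncurry) hA,
    Measure.prod_apply (((measurable_walk x).comp measurable_prepend_uncurry) hA),
    lintegral_stepLaw, Measure.smul_apply, Measure.finsetSum_apply, smul_eq_mul]
  congr 1
  refine Finset.sum_congr rfl fun e _ => ?_
  rw [Measure.map_apply (measurable_prepend x) hA, walkLaw,
    Measure.map_apply (measurable_walk _) hA']
  congr 1
  ext ξ
  simp only [Set.mem_preimage, Function.comp_apply]
  have : (fun n => x + ∑ i ∈ Finset.range n, prepend e ξ i) =
      prepend x fun n => x + e + ∑ i ∈ Finset.range n, ξ i := by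
    funext n
    cases n with
    | zero => simp
    | succ n =>
      rw [Finset.sum_range_succ']
      simp only [prepend_succ, prepend_zero]
      abel
  rw [this]

lemma walkLaw_apply {d : ℕ} (hd : 0 < d) (x : Site d) {A : Set (ℕ → Site d)}
    (hA : MeasurableSet A) :
    walkLaw x A = (2 * d : ℝ≥0∞)⁻¹ * ∑ e ∈ nbrs d, walkLaw (x + e) (prepend x ⁻¹' A) := by
  conv_lhs => rw [walkLaw_eq hd x]
  rw [Measure.smul_apply, Measure.finsetSum_apply, smul_eq_mul]
  congr 1
  exact Finset.sum_congr rfl fun e _ => Measure.map_apply (measurable_prepend x) hA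

lemma walkLaw_start {d : ℕ} (hd : 0 < d) (x : Site d) : ∀ᵐ w ∂walkLaw x, w 0 = x := by
  have := isProbabilityMeasure_walkLaw hd x
  have : MeasurableSet {w : ℕ → Site d | w 0 = x} :=
    measurableSet_eq_fun (measurable_pi_apply 0) measurable_const
  rw [walkLaw, ae_map_iff (measurable_walk x).aemeasurable this]
  simp

lemma walkLaw_nearest {d : ℕ} (hd : 0 < d) (x : Site d) :
    ∀ᵐ w ∂walkLaw x, ∀ n, l1 (w (n + 1) - w n) = 1 := by
  have := isProbabilityMeasure_stepLaw hd
  have hm : MeasurableSet {w : ℕ → Site d | ∀ n, l1 (w (n + 1) - w n) = 1} := by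
    rw [Set.ofPred_forall]
    refine MeasurableSet.iInter fun n => ?_
    have : Measurable fun w : ℕ → Site d => w (n + 1) - w n := by fun_prop
    exact this (MeasurableSet.of_discrete (s := {e : Site d | l1 e = 1}))
  rw [walkLaw, ae_map_iff (measurable_walk x).aemeasurable hm, ae_all_iff]
  intro n
  simp only [Finset.sum_range_succ]
  have hstep : ∀ᵐ e ∂stepLaw d, l1 e = 1 := by
    rw [ae_iff, ← nonpos_iff_eq_zero, stepLaw]
    refine (uniformOn_eq_zero_iff ?_).2 ?_ |>.le
    · rw [coe_nbrs]
      exact (nbrs d).finite_toSet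
    · ext e
      simp
  have := (measurePreserving_eval_infinitePi (fun _ : ℕ => stepLaw d) n).quasiMeasurePreserving.ae
    hstep
  filter_upwards [this] with ξ hξ
  simpa using hξ

/-! ### Transition probabilities -/

/-- The probability that the walk from `x` is at `y` at time `n`. -/
def trans {d : ℕ} (n : ℕ) (x y : Site d) : ℝ≥0∞ := walkLaw x {w | w n = y}

lemma measurableSet_at {d : ℕ} (n : ℕ) (y : Site d) :
    MeasurableSet {w : ℕ → Site d | w n = y} :=
  measurableSet_eq_fun (measurable_pi_apply n) measurable_const

lemma trans_zero {d : ℕ} (hd : 0 < d) (x y : Site d) :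
    trans 0 x y = if x = y then 1 else 0 := by
  have := isProbabilityMeasure_walkLaw hd x
  rw [trans]
  split_ifs with h
  · rw [← mem_ae_iff_prob_eq_one (measurableSet_at 0 y)]
    filter_upwards [walkLaw_start hd x] with w hw
    simp [hw, h]
  · rw [← nonpos_iff_eq_zero, ← ae_iff.1 (walkLaw_start hd x)]
    refine measure_mono fun w hw => ?_
    simp only [Set.mem_ofPred_eq] at hw ⊢
    rw [hw]
    exact fun h' => h h'.symm

lemma trans_succ {d : ℕ} (hd : 0 < d) (n : ℕ) (x y : Site d) :
    trans (n + 1) x y = (2 * d : ℝ≥0∞)⁻¹ * ∑ e ∈ nbrs d, trans n (x + e) y :=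
  walkLaw_apply hd x (measurableSet_at (n + 1) y)

/-- The Markov property at time `n`. -/
lemma walkLaw_markov {d : ℕ} (hd : 0 < d) {A : Set (ℕ → Site d)} (hA : MeasurableSet A) (n : ℕ)
    (x y : Site d) :
    walkLaw x {w | w n = y ∧ (fun k => w (n + k)) ∈ A} = trans n x y * walkLaw y A := by
  have hshift : ∀ n : ℕ, Measurable fun (w : ℕ → Site d) k => w (n + k) := fun n => by fun_prop
  induction n generalizing x with
  | zero =>
    rw [trans_zero hd]
    split_ifs with h
    · subst h
      rw [one_mul]
      refine measure_congr ?_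
      filter_upwards [walkLaw_start hd x] with w hw
      refine propext ?_
      change (w 0 = x ∧ (fun k => w (0 + k)) ∈ A) ↔ w ∈ A
      simp [hw]
    · rw [zero_mul, ← nonpos_iff_eq_zero, ← ae_iff.1 (walkLaw_start hd x)]
      refine measure_mono fun w hw => ?_
      simp only [Set.mem_ofPred_eq] at hw ⊢
      rw [hw.1]
      exact fun h' => h h'.symm
  | succ n ih =>
    have hm : MeasurableSet {w : ℕ → Site d | w (n + 1) = y ∧ (fun k => w (n + 1 + k)) ∈ A} :=
      (measurableSet_at (n + 1) y).inter (hshift (n + 1) hA)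
    rw [walkLaw_apply hd x hm, trans_succ hd, mul_assoc, Finset.sum_mul]
    congr 1
    refine Finset.sum_congr rfl fun e _ => ?_
    rw [← ih]
    congr 1
    ext w
    simp only [Set.mem_preimage, Set.mem_ofPred_eq, prepend_succ]
    simp only [show ∀ k, n + 1 + k = n + k + 1 by intro k; omega, prepend_succ]

lemma trans_add_right {d : ℕ} (hd : 0 < d) (n : ℕ) (x y z : Site d) :
    trans n (x + z) (y + z) = trans n x y := by
  induction n generalizing x with
  | zero => simp [trans_zero hd]
  | succ n ih =>
    rw [trans_succ hd, trans_succ hd]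
    congr 1
    refine Finset.sum_congr rfl fun e _ => ?_
    rw [add_right_comm, ih]

lemma neg_mem_nbrs {d : ℕ} {e : Site d} : -e ∈ nbrs d ↔ e ∈ nbrs d := by
  simp [mem_nbrs, l1]

lemma trans_neg {d : ℕ} (hd : 0 < d) (n : ℕ) (x y : Site d) :
    trans n (-x) (-y) = trans n x y := by
  induction n generalizing x with
  | zero => simp [trans_zero hd]
  | succ n ih =>
    rw [trans_succ hd, trans_succ hd]
    congr 1
    refine Finset.sum_nbij' (fun e => -e) (fun e => -e) ?_ ?_ ?_ ?_ ?_
    · exact fun e he => neg_mem_nbrs.2 he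
    · exact fun e he => neg_mem_nbrs.2 he
    · simp
    · simp
    · intro e _
      rw [← ih]
      congr 1
      abel

/-- Negation followed by translation by `x + y` exchanges `x` and `y`, and both maps preserve the
transition probabilities. -/
lemma trans_symm {d : ℕ} (hd : 0 < d) (n : ℕ) (x y : Site d) : trans n x y = trans n y x := by
  rw [← trans_neg hd n x y, ← trans_add_right hd n _ _ (x + y)]
  congr 1 <;> abel

lemma green_eq {d : ℕ} (x y : Site d) : green x y = ∑' n, trans n x y := rfl

lemma green_symm {d : ℕ} (hd : 0 < d) (x y : Site d) : green x y = green y x := by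
  simp only [green_eq, trans_symm hd _ x y]

lemma trans_le_one {d : ℕ} (hd : 0 < d) (n : ℕ) (x y : Site d) : trans n x y ≤ 1 :=
  have := isProbabilityMeasure_walkLaw hd x
  prob_le_one

/-! ### Transience in dimension at least three -/

/-- The Taylor coefficient of `y ^ 2` is `5/32`. Raising it to `3/16` absorbs the remainder for `|y|
≤ 1/10`. After taking fourth powers the claim is polynomial. -/
lemma inv_fourth_root_le {y : ℝ} (hy : |y| ≤ 1 / 10) :
    (1 - y) ^ (-(1 / 4) : ℝ) ≤ 1 + y / 4 + 3 * y ^ 2 / 16 := by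
  obtain ⟨h1, h2⟩ := abs_le.1 hy
  have hq : 0 ≤ 1 + y / 4 + 3 * y ^ 2 / 16 := by nlinarith [sq_nonneg y]
  have h0 : 0 < 1 - y := by linarith
  have hpoly : 1 ≤ (1 + y / 4 + 3 * y ^ 2 / 16) ^ 4 * (1 - y) := by
    -- Squaring twice; the nonnegative quartic term of the first square is dropped.
    have hq2 : (1 + y / 4 + 3 * y ^ 2 / 16) ^ 2 ≥ 1 + y / 2 + 7 / 16 * y ^ 2 + 3 / 32 * y ^ 3 := by
      nlinarith [sq_nonneg (y ^ 2)]
    have hpos : 0 ≤ 1 + y / 2 + 7 / 16 * y ^ 2 + 3 / 32 * y ^ 3 := by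
      nlinarith [sq_nonneg y, sq_nonneg (y + 1)]
    have h4 : (1 + y / 4 + 3 * y ^ 2 / 16) ^ 4 ≥
        (1 + y / 2 + 7 / 16 * y ^ 2 + 3 / 32 * y ^ 3) ^ 2 := by
      nlinarith
    have : (1 + y / 2 + 7 / 16 * y ^ 2 + 3 / 32 * y ^ 3) ^ 2 * (1 - y) - 1 =
        y ^ 2 * (1 / 8 - 1 / 2 * y - 87 / 256 * y ^ 2 - 52 / 256 * y ^ 3 - 75 / 1024 * y ^ 4
          - 9 / 1024 * y ^ 5) := by ring
    have hb : 0 ≤ 1 / 8 - 1 / 2 * y - 87 / 256 * y ^ 2 - 52 / 256 * y ^ 3 - 75 / 1024 * y ^ 4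
          - 9 / 1024 * y ^ 5 := by
      have e2 : |y| ^ 2 ≤ (1 / 10) ^ 2 := pow_le_pow_left₀ (abs_nonneg y) hy 2
      have e3 : |y| ^ 3 ≤ (1 / 10) ^ 3 := pow_le_pow_left₀ (abs_nonneg y) hy 3
      have e4 : |y| ^ 4 ≤ (1 / 10) ^ 4 := pow_le_pow_left₀ (abs_nonneg y) hy 4
      have e5 : |y| ^ 5 ≤ (1 / 10) ^ 5 := pow_le_pow_left₀ (abs_nonneg y) hy 5
      rw [← abs_pow] at e2 e3 e4 e5
      have f2 := (abs_le.1 e2).2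
      have f3 := (abs_le.1 e3).2
      have f4 := (abs_le.1 e4).2
      have f5 := (abs_le.1 e5).2
      norm_num at f2 f3 f4 f5
      linarith
    nlinarith [mul_nonneg (sq_nonneg y) hb]
  have h3 : (1 - y)⁻¹ ≤ (1 + y / 4 + 3 * y ^ 2 / 16) ^ 4 := by
    rw [inv_le_iff_one_le_mul₀ h0]
    exact hpoly
  rw [Real.rpow_neg h0.le, ← Real.inv_rpow h0.le]
  calc ((1 - y)⁻¹) ^ (1 / 4 : ℝ)
      ≤ ((1 + y / 4 + 3 * y ^ 2 / 16) ^ 4) ^ (1 / 4 : ℝ) :=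
        Real.rpow_le_rpow (inv_nonneg.2 h0.le) h3 (by norm_num)
    _ = 1 + y / 4 + 3 * y ^ 2 / 16 := by
        rw [← Real.rpow_natCast, ← Real.rpow_mul hq]
        norm_num

lemma one_add_le_inv_fourth_root {s : ℝ} (hs : 0 ≤ s) (hs1 : s < 1) :
    1 + s / 4 ≤ (1 - s) ^ (-(1 / 4) : ℝ) := by
  have h0 : 0 < 1 - s := by linarith
  have h1 : (1 - s) ^ (1 / 4 : ℝ) ≤ 1 - s / 4 := by
    have := rpow_one_add_le_one_add_mul_self (s := -s) (by linarith) (p := 1 / 4)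
      (by norm_num) (by norm_num)
    rw [← sub_eq_add_neg] at this
    linarith
  rw [Real.rpow_neg h0.le, le_inv_comm₀ (by linarith) (Real.rpow_pos_of_pos h0 _)]
  refine h1.trans ?_
  rw [← one_div, le_div_iff₀ (by linarith)]
  nlinarith [sq_nonneg s]

/-- The squared Euclidean norm. -/
def normSq {d : ℕ} (x : Site d) : ℝ := ∑ i, (x i : ℝ) ^ 2

lemma normSq_add_single {d : ℕ} (x : Site d) (i : Fin d) (ε : ℤ) :
    normSq (x + Pi.single i ε) = normSq x + 2 * ε * x i + (ε : ℝ) ^ 2 := by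
  have h : ∀ j, (((x + Pi.single i ε : Site d) j : ℤ) : ℝ) ^ 2 =
      (x j : ℝ) ^ 2 + if j = i then 2 * ε * (x i : ℝ) + (ε : ℝ) ^ 2 else 0 := by
    intro j
    rcases eq_or_ne j i with rfl | hj
    · simp
      ring
    · simp [hj]
  rw [normSq, Finset.sum_congr rfl fun j _ => h j, Finset.sum_add_distrib]
  simp [normSq, add_assoc]

/-- A strictly superharmonic function for simple random walk in dimension at least three. -/
def lyapunov {d : ℕ} (x : Site d) : ℝ := (normSq x + 99) ^ (-(1 / 4) : ℝ)

lemma normSq_nonneg {d : ℕ} (x : Site d) : 0 ≤ normSq x := Finset.sum_nonneg fun _ _ => sq_nonneg _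

lemma lyapunov_nonneg {d : ℕ} (x : Site d) : 0 ≤ lyapunov x :=
  Real.rpow_nonneg (by have := normSq_nonneg x; linarith) _

lemma lyapunov_le_one {d : ℕ} (x : Site d) : lyapunov x ≤ 1 :=
  Real.rpow_le_one_of_one_le_of_nonpos (by have := normSq_nonneg x; linarith) (by norm_num)

lemma sum_lyapunov_lt {d : ℕ} (hd : 3 ≤ d) (x : Site d) :
    ∑ e ∈ nbrs d, lyapunov (x + e) < 2 * d * lyapunov x := by
  have hρ := normSq_nonneg x
  -- The shift `99` is chosen so that the base of `lyapunov` is `r ± 2 x_i` at the neighbours and `r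
  -- - 1` at `x`. Then `20 |x_i| ≤ x_i ^ 2 + 100 ≤ r` puts `2 x_i / r` within the range of the
  -- fourth-root estimate.
  set r : ℝ := normSq x + 100 with hr
  have hr0 : 0 < r := by linarith
  have hd' : (3 : ℝ) ≤ d := by exact_mod_cast hd
  have hy : ∀ i, |2 * (x i : ℝ) / r| ≤ 1 / 10 := by
    intro i
    have : (x i : ℝ) ^ 2 ≤ normSq x :=
      Finset.single_le_sum (f := fun i => (x i : ℝ) ^ 2) (fun _ _ => sq_nonneg _)
        (Finset.mem_univ i)
    rw [abs_div, abs_of_pos hr0, div_le_iff₀ hr0, abs_le]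
    constructor <;> nlinarith [sq_nonneg ((x i : ℝ) - 10), sq_nonneg ((x i : ℝ) + 10)]
  have hrq : 0 < r ^ (-(1 / 4) : ℝ) := Real.rpow_pos_of_pos hr0 _
  have hstep : ∀ i, lyapunov (x + Pi.single i 1) + lyapunov (x + Pi.single i (-1)) ≤
      r ^ (-(1 / 4) : ℝ) * (2 + 3 / 8 * (2 * (x i : ℝ) / r) ^ 2) := by
    intro i
    have e1 : lyapunov (x + Pi.single i 1) =
        r ^ (-(1 / 4) : ℝ) * (1 - (-(2 * (x i : ℝ) / r))) ^ (-(1 / 4) : ℝ) := by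
      rw [lyapunov, normSq_add_single, ← Real.mul_rpow hr0.le (by linarith [(abs_le.1 (hy i)).1])]
      congr 1
      push_cast
      field_simp
      ring
    have e2 : lyapunov (x + Pi.single i (-1)) =
        r ^ (-(1 / 4) : ℝ) * (1 - 2 * (x i : ℝ) / r) ^ (-(1 / 4) : ℝ) := by
      rw [lyapunov, normSq_add_single, ← Real.mul_rpow hr0.le (by linarith [(abs_le.1 (hy i)).2])]
      congr 1
      push_cast
      field_simp
      ring
    rw [e1, e2, ← mul_add]
    refine mul_le_mul_of_nonneg_left ?_ hrq.le
    have i1 := inv_fourth_root_le (hy i)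
    have i2 := inv_fourth_root_le (y := -(2 * (x i : ℝ) / r)) (by rw [abs_neg]; exact hy i)
    linarith
  have hx : r ^ (-(1 / 4) : ℝ) * (1 + 1 / r / 4) ≤ lyapunov x := by
    have e : lyapunov x = r ^ (-(1 / 4) : ℝ) * (1 - 1 / r) ^ (-(1 / 4) : ℝ) := by
      have : 1 / r ≤ 1 := by
        rw [div_le_one hr0]
        linarith
      rw [lyapunov, ← Real.mul_rpow hr0.le (by linarith)]
      congr 1
      field_simp
      linarith
    rw [e]
    refine mul_le_mul_of_nonneg_left (one_add_le_inv_fourth_root (by positivity) ?_) hrq.le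
    rw [div_lt_one hr0]
    linarith
  have hsum : ∑ i, (2 + 3 / 8 * (2 * (x i : ℝ) / r) ^ 2) = 2 * d + 3 / 2 * normSq x / r ^ 2 := by
    rw [Finset.sum_add_distrib, ← Finset.mul_sum]
    have : ∀ i, (2 * (x i : ℝ) / r) ^ 2 = (4 / r ^ 2) * (x i : ℝ) ^ 2 := fun i => by
      field_simp
      ring
    simp only [this]
    rw [← Finset.mul_sum, ← normSq]
    simp
    ring
  calc ∑ e ∈ nbrs d, lyapunov (x + e)
      ≤ ∑ i, r ^ (-(1 / 4) : ℝ) * (2 + 3 / 8 * (2 * (x i : ℝ) / r) ^ 2) := by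
        rw [sum_nbrs]
        exact Finset.sum_le_sum fun i _ => hstep i
    _ = r ^ (-(1 / 4) : ℝ) * (2 * d + 3 / 2 * normSq x / r ^ 2) := by
        rw [← Finset.mul_sum, hsum]
    _ < r ^ (-(1 / 4) : ℝ) * (2 * d * (1 + 1 / r / 4)) := by
        refine mul_lt_mul_of_pos_left ?_ hrq
        -- This amounts to `3 * normSq x < d * r`, the one place where `d ≥ 3` is decisive;
        -- strictness comes from `normSq x < r`.
        have : 3 / 2 * normSq x / r ^ 2 < 2 * d * (1 / r / 4) := by
          rw [div_lt_iff₀ (by positivity)]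
          have : 2 * (d : ℝ) * (1 / r / 4) * r ^ 2 = d / 2 * r := by
            field_simp
            ring
          rw [this]
          nlinarith
        linarith
    _ ≤ 2 * d * lyapunov x := by
        nlinarith

/-- A nonnegative superharmonic function with defect at least `δ` at `y` pays `δ` at each visit to
`y`, so `δ` times the expected number of visits cannot exceed its initial value. -/
lemma sum_trans_mul_le {d : ℕ} (hd : 0 < d) {h : Site d → ℝ≥0∞} {y : Site d} {δ : ℝ≥0∞}
    (hh : ∀ x, (if x = y then δ else 0) + (2 * d : ℝ≥0∞)⁻¹ * ∑ e ∈ nbrs d, h (x + e) ≤ h x)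
    (n : ℕ) (x : Site d) : ∑ k ∈ Finset.range n, trans k x y * δ ≤ h x := by
  induction n generalizing x with
  | zero => simp
  | succ n ih =>
    rw [Finset.sum_range_succ']
    refine le_trans ?_ (hh x)
    rw [add_comm]
    refine add_le_add (by rw [trans_zero hd]; split_ifs <;> simp) ?_
    simp only [trans_succ hd, mul_assoc, Finset.sum_mul]
    rw [← Finset.mul_sum, Finset.sum_comm]
    exact mul_le_mul_right (Finset.sum_le_sum fun e _ => ih (x + e)) _

/-- The Green function is bounded, in dimension at least three. -/
theorem exists_green_le {d : ℕ} (hd : 3 ≤ d) (y : Site d) : ∃ C : NNReal, ∀ x, green x y ≤ C := by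
  have hd0 : 0 < d := by omega
  have hdr : (0 : ℝ) < 2 * d := by positivity
  -- The superharmonic defect at `y`. Since `lyapunov ≤ 1`, the bound `1 / δ` follows, uniformly in
  -- the starting point.
  set δ : ℝ := lyapunov y - (2 * d : ℝ)⁻¹ * ∑ e ∈ nbrs d, lyapunov (y + e) with hδ
  have havg : ∀ x : Site d, (2 * d : ℝ)⁻¹ * ∑ e ∈ nbrs d, lyapunov (x + e) < lyapunov x := by
    intro x
    rw [inv_mul_lt_iff₀ hdr]
    exact sum_lyapunov_lt hd x
  have hδ0 : 0 < δ := sub_pos.2 (havg y)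
  have key : ∀ x : Site d, (if x = y then ENNReal.ofReal δ else 0) +
      (2 * d : ℝ≥0∞)⁻¹ * ∑ e ∈ nbrs d, ENNReal.ofReal (lyapunov (x + e)) ≤
        ENNReal.ofReal (lyapunov x) := by
    intro x
    have e1 : (2 * d : ℝ≥0∞)⁻¹ = ENNReal.ofReal ((2 * d : ℝ)⁻¹) := by
      rw [ENNReal.ofReal_inv_of_pos hdr, ENNReal.ofReal_mul (by norm_num)]
      simp
    have e2 : (if x = y then ENNReal.ofReal δ else 0) = ENNReal.ofReal (if x = y then δ else 0) := by
      split_ifs <;> simp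
    have h0 : 0 ≤ ∑ e ∈ nbrs d, lyapunov (x + e) := Finset.sum_nonneg fun _ _ => lyapunov_nonneg _
    rw [← ENNReal.ofReal_sum_of_nonneg (fun _ _ => lyapunov_nonneg _), e1, e2,
      ← ENNReal.ofReal_mul (by positivity), ← ENNReal.ofReal_add (by split_ifs <;> linarith)
      (by positivity)]
    refine ENNReal.ofReal_le_ofReal ?_
    split_ifs with h
    · subst h
      linarith
    · have := havg x
      linarith
  refine ⟨(1 / δ).toNNReal, fun x => ?_⟩
  have h1 : green x y * ENNReal.ofReal δ ≤ 1 := by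
    rw [green_eq, ← ENNReal.tsum_mul_right, ENNReal.tsum_eq_iSup_nat]
    refine iSup_le fun n => (sum_trans_mul_le hd0 key n x).trans ?_
    rw [← ENNReal.ofReal_one]
    exact ENNReal.ofReal_le_ofReal (lyapunov_le_one x)
  change green x y ≤ ENNReal.ofReal (1 / δ)
  rw [ENNReal.ofReal_div_of_pos hδ0, ENNReal.ofReal_one]
  exact (ENNReal.le_div_iff_mul_le (Or.inl (by simpa using hδ0)) (Or.inl ENNReal.ofReal_ne_top)).2 h1

lemma green_ne_top {d : ℕ} (hd : 3 ≤ d) (x y : Site d) : green x y ≠ ∞ := by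
  obtain ⟨C, hC⟩ := exists_green_le hd y
  exact ((hC x).trans_lt ENNReal.coe_lt_top).ne

/-- Borel–Cantelli, the Green function being the sum of the probabilities of the visits. -/
lemma walkLaw_transient {d : ℕ} (hd : 3 ≤ d) (x : Site d) :
    ∀ᵐ w ∂walkLaw x, ∀ y, {n | w n = y}.Finite := by
  rw [ae_all_iff]
  intro y
  have h := ae_finite_setOfPred_mem (μ := walkLaw x) (s := fun n => {w : ℕ → Site d | w n = y})
    (green_ne_top hd x y)
  exact h

/-! ### The Feynman–Kac equation -/

lemma trans_ne_top {d : ℕ} (hd : 0 < d) (n : ℕ) (x y : Site d) : trans n x y ≠ ∞ :=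
  ((trans_le_one hd n x y).trans_lt ENNReal.one_lt_top).ne

lemma toReal_trans_succ {d : ℕ} (hd : 0 < d) (n : ℕ) (x y : Site d) :
    (trans (n + 1) x y).toReal = (2 * d : ℝ)⁻¹ * ∑ e ∈ nbrs d, (trans n (x + e) y).toReal := by
  rw [trans_succ hd, ENNReal.toReal_mul, ENNReal.toReal_inv, ENNReal.toReal_mul,
    ENNReal.toReal_sum fun e _ => trans_ne_top hd n _ _]
  simp

lemma hasSum_toReal_trans {d : ℕ} (hd : 3 ≤ d) (x y : Site d) :
    HasSum (fun n => (trans n x y).toReal) (green x y).toReal := by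
  rw [green_eq, ENNReal.tsum_toReal_eq fun n => trans_ne_top (by omega) n x y]
  exact (ENNReal.summable_toReal (green_ne_top hd x y)).hasSum

lemma integral_walkLaw {d : ℕ} (hd : 0 < d) (x : Site d) {f : (ℕ → Site d) → ℂ}
    (hf : Measurable f) {B : ℝ} (hB : ∀ w, ‖f w‖ ≤ B) :
    ∫ w, f w ∂walkLaw x =
      (2 * d : ℂ)⁻¹ * ∑ e ∈ nbrs d, ∫ w, f (prepend x w) ∂walkLaw (x + e) := by
  have hint : ∀ e ∈ nbrs d, Integrable f ((walkLaw (x + e)).map (prepend x)) := by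
    intro e _
    have := isProbabilityMeasure_walkLaw hd (x + e)
    have := Measure.isProbabilityMeasure_map (μ := walkLaw (x + e))
      (measurable_prepend x).aemeasurable
    exact Integrable.of_bound hf.aestronglyMeasurable B (ae_of_all _ hB)
  conv_lhs => rw [walkLaw_eq hd x]
  rw [integral_smul_measure, integral_finsetSum_measure hint]
  simp only [integral_map (measurable_prepend x).aemeasurable hf.aestronglyMeasurable]
  rw [ENNReal.toReal_inv, ENNReal.toReal_mul, Complex.real_smul]
  simp

/-- The product of `(1 - V)⁻¹` along the first `n` sites of a trajectory. -/
def pathProd {d : ℕ} (V : Site d → ℂ) (n : ℕ) (w : ℕ → Site d) : ℂ :=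
  ∏ k ∈ Finset.range n, (1 - V (w k))⁻¹

lemma pathProd_prepend {d : ℕ} (V : Site d → ℂ) (n : ℕ) (x : Site d) (w : ℕ → Site d) :
    pathProd V (n + 1) (prepend x w) = (1 - V x)⁻¹ * pathProd V n w := by
  rw [pathProd, Finset.prod_range_succ', mul_comm]
  simp [pathProd]

lemma measurable_pathProd {d : ℕ} (V : Site d → ℂ) (n : ℕ) : Measurable (pathProd V n) := by
  refine Finset.measurable_fun_prod _ fun k _ => ?_
  exact (Measurable.of_discrete (f := fun y : Site d => (1 - V y)⁻¹)).comp (measurable_pi_apply k)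

lemma one_half_le_norm_one_sub {z : ℂ} (hz : ‖z‖ ≤ 1 / 2) : 1 / 2 ≤ ‖1 - z‖ := by
  have := norm_sub_norm_le (1 : ℂ) z
  rw [norm_one] at this
  linarith

/-- A crude bound, growing with `n`. It provides integrability at fixed `n` and the starting point
for the bootstrap in `norm_fk_le_two`. -/
lemma norm_pathProd_le {d : ℕ} {V : Site d → ℂ} (hV : ∀ x, ‖V x‖ ≤ 1 / 2) (n : ℕ)
    (w : ℕ → Site d) : ‖pathProd V n w‖ ≤ 2 ^ n := by
  rw [pathProd, norm_prod]
  refine (Finset.prod_le_prod (g := fun _ => 2) (fun _ _ => norm_nonneg _) fun k _ => ?_).trans_eq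
    (by simp)
  rw [norm_inv, inv_le_comm₀ (by linarith [one_half_le_norm_one_sub (hV (w k))]) (by norm_num)]
  linarith [one_half_le_norm_one_sub (hV (w k))]

/-- The expectation of `pathProd`. -/
def fk {d : ℕ} (V : Site d → ℂ) (n : ℕ) (x : Site d) : ℂ := ∫ w, pathProd V n w ∂walkLaw x

lemma fk_zero {d : ℕ} (hd : 0 < d) (V : Site d → ℂ) (x : Site d) : fk V 0 x = 1 := by
  have := isProbabilityMeasure_walkLaw hd x
  simp [fk, pathProd]

lemma norm_fk_le {d : ℕ} (hd : 0 < d) {V : Site d → ℂ} (hV : ∀ x, ‖V x‖ ≤ 1 / 2) (n : ℕ)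
    (x : Site d) : ‖fk V n x‖ ≤ 2 ^ n := by
  have := isProbabilityMeasure_walkLaw hd x
  simpa [fk] using norm_integral_le_of_norm_le_const (μ := walkLaw x)
    (ae_of_all _ (norm_pathProd_le hV n))

/-- The factor `(1 - V x)⁻¹` is cleared on purpose: in this implicit form `V` enters linearly as a
source term, and iteration produces the Green function. -/
lemma fk_succ {d : ℕ} (hd : 0 < d) {V : Site d → ℂ} (hV : ∀ x, ‖V x‖ ≤ 1 / 2) (n : ℕ)
    (x : Site d) :
    fk V (n + 1) x = V x * fk V (n + 1) x + (2 * d : ℂ)⁻¹ * ∑ e ∈ nbrs d, fk V n (x + e) := by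
  have h1 : fk V (n + 1) x =
      (1 - V x)⁻¹ * ((2 * d : ℂ)⁻¹ * ∑ e ∈ nbrs d, fk V n (x + e)) := by
    rw [fk, integral_walkLaw hd x (measurable_pathProd V _) (norm_pathProd_le hV _)]
    simp only [pathProd_prepend, integral_const_mul, ← Finset.mul_sum]
    rw [mul_left_comm]
    rfl
  have h2 : 1 - V x ≠ 0 := norm_pos_iff.1 (by linarith [one_half_le_norm_one_sub (hV x)])
  have h3 : (1 - V x) * fk V (n + 1) x = (2 * d : ℂ)⁻¹ * ∑ e ∈ nbrs d, fk V n (x + e) := by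
    rw [h1, ← mul_assoc, mul_inv_cancel₀ h2, one_mul]
  rw [← h3]
  ring

/-- Duhamel's formula: each iteration of `fk_succ` leaves a source `V * fk` at the current site, and
the source met after `k` steps has `n - k` factors left. The subtraction never truncates, because `k
< n`. -/
lemma fk_eq {d : ℕ} (hd : 0 < d) {K : Finset (Site d)} {V : Site d → ℂ}
    (hV : ∀ x, ‖V x‖ ≤ 1 / 2) (hK : ∀ x, x ∉ K → V x = 0) (n : ℕ) (x : Site d) :
    fk V n x = 1 + ∑ k ∈ Finset.range n, ∑ y ∈ K,
      ((trans k x y).toReal : ℂ) * (V y * fk V (n - k) y) := by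
  induction n generalizing x with
  | zero => simp [fk_zero hd]
  | succ n ih =>
    have h0 : ∑ y ∈ K, ((trans 0 x y).toReal : ℂ) * (V y * fk V (n + 1 - 0) y) =
        V x * fk V (n + 1) x := by
      by_cases hx : x ∈ K
      · rw [Finset.sum_eq_single_of_mem x hx]
        · simp [trans_zero hd]
        · intro y _ hy
          simp [trans_zero hd, hy.symm]
      · rw [hK x hx, zero_mul]
        refine Finset.sum_eq_zero fun y hy => ?_
        have : x ≠ y := fun h => hx (h ▸ hy)
        simp [trans_zero hd, this]
    have hd' : (2 * d : ℂ) ≠ 0 := by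
      have : (d : ℂ) ≠ 0 := by exact_mod_cast hd.ne'
      simpa using this
    have hcard : (2 * d : ℂ)⁻¹ * ∑ _e ∈ nbrs d, (1 : ℂ) = 1 := by
      rw [Finset.sum_const, card_nbrs]
      simp only [nsmul_eq_mul, mul_one]
      push_cast
      exact inv_mul_cancel₀ hd'
    rw [fk_succ hd hV, Finset.sum_range_succ', h0]
    simp only [ih]
    rw [Finset.sum_add_distrib, mul_add, hcard]
    have h1 : (2 * d : ℂ)⁻¹ * ∑ e ∈ nbrs d, ∑ k ∈ Finset.range n, ∑ y ∈ K,
        ((trans k (x + e) y).toReal : ℂ) * (V y * fk V (n - k) y) =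
        ∑ k ∈ Finset.range n, ∑ y ∈ K,
          ((trans (k + 1) x y).toReal : ℂ) * (V y * fk V (n + 1 - (k + 1)) y) := by
      rw [Finset.sum_comm, Finset.mul_sum]
      refine Finset.sum_congr rfl fun k _ => ?_
      rw [Finset.sum_comm, Finset.mul_sum]
      refine Finset.sum_congr rfl fun y _ => ?_
      rw [toReal_trans_succ hd, ← Finset.sum_mul, Nat.add_sub_add_right]
      push_cast
      ring
    rw [h1]
    ring

/-! ### Small potentials: uniform bounds and the limit equation -/

/-- The smallness condition on the sup-norm of a potential supported in `K`. -/
structure IsSmall {d : ℕ} (K : Finset (Site d)) (c : ℝ) : Prop where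
  pos : 0 < c
  le_half : c ≤ 1 / 2
  green_le : ∀ x, ∑ y ∈ K, (green x y).toReal * c ≤ 1 / 2

lemma exists_isSmall {d : ℕ} (hd : 3 ≤ d) (K : Finset (Site d)) : ∃ c, IsSmall K c := by
  choose C hC using exists_green_le hd
  have hS : 0 ≤ ∑ y ∈ K, (C y : ℝ) := Finset.sum_nonneg fun y _ => (C y).2
  -- The added `1` keeps the denominator positive when `K` is empty and forces `c ≤ 1/2`.
  refine ⟨1 / (2 * (1 + ∑ y ∈ K, (C y : ℝ))), by positivity, ?_, fun x => ?_⟩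
  · exact one_div_le_one_div_of_le (by norm_num) (by linarith)
  · rw [← Finset.sum_mul]
    have h1 : ∑ y ∈ K, (green x y).toReal ≤ ∑ y ∈ K, (C y : ℝ) :=
      Finset.sum_le_sum fun y _ => ENNReal.toReal_le_coe_of_le_coe (hC y x)
    rw [mul_one_div, div_le_div_iff₀ (by positivity) (by norm_num)]
    linarith

/-- Bootstrap: a bound `B` valid for all indices up to `n` improves, through `fk_eq` and smallness,
to `1 + B / 2`, whose fixed point is `2`. Starting from `2 + 2 ^ n`, each round halves the excess
over `2`. -/
lemma norm_fk_le_two {d : ℕ} (hd : 3 ≤ d) {K : Finset (Site d)} {c : ℝ} (hc : IsSmall K c)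
    {V : Site d → ℂ} (hV : ∀ x, ‖V x‖ ≤ c) (hK : ∀ x, x ∉ K → V x = 0) (n : ℕ) (x : Site d) :
    ‖fk V n x‖ ≤ 2 := by
  have hd0 : 0 < d := by omega
  have hV' : ∀ x, ‖V x‖ ≤ 1 / 2 := fun x => (hV x).trans hc.le_half
  have key : ∀ m : ℕ, ∀ j ≤ n, ∀ x, ‖fk V j x‖ ≤ 2 + 2 ^ n / 2 ^ m := by
    intro m
    induction m with
    | zero =>
      intro j hj x
      have h1 := norm_fk_le hd0 hV' j x
      have h2 : (2 : ℝ) ^ j ≤ 2 ^ n := pow_le_pow_right₀ (by norm_num) hj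
      simp only [pow_zero, div_one]
      linarith
    | succ m ih =>
      intro j hj x
      set B : ℝ := 2 + 2 ^ n / 2 ^ m with hB
      have hB0 : 0 ≤ B := by positivity
      have h1 : ‖∑ k ∈ Finset.range j, ∑ y ∈ K,
          ((trans k x y).toReal : ℂ) * (V y * fk V (j - k) y)‖ ≤ 1 / 2 * B := by
        calc _ ≤ ∑ k ∈ Finset.range j, ∑ y ∈ K, (trans k x y).toReal * (c * B) := by
              refine (norm_sum_le _ _).trans (Finset.sum_le_sum fun k _ => ?_)
              refine (norm_sum_le _ _).trans (Finset.sum_le_sum fun y _ => ?_)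
              rw [norm_mul, norm_mul, Complex.norm_real, Real.norm_of_nonneg ENNReal.toReal_nonneg]
              exact mul_le_mul_of_nonneg_left
                (mul_le_mul (hV y) (ih _ (by omega) y) (norm_nonneg _) hc.pos.le)
                ENNReal.toReal_nonneg
          _ = ∑ y ∈ K, (∑ k ∈ Finset.range j, (trans k x y).toReal) * (c * B) := by
              rw [Finset.sum_comm]
              simp only [Finset.sum_mul]
          _ ≤ ∑ y ∈ K, (green x y).toReal * (c * B) := by
              refine Finset.sum_le_sum fun y _ => mul_le_mul_of_nonneg_right ?_
                (mul_nonneg hc.pos.le hB0)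
              exact sum_le_hasSum _ (fun _ _ => ENNReal.toReal_nonneg) (hasSum_toReal_trans hd x y)
          _ = (∑ y ∈ K, (green x y).toReal * c) * B := by
              rw [Finset.sum_mul]
              simp only [mul_assoc]
          _ ≤ 1 / 2 * B := mul_le_mul_of_nonneg_right (hc.green_le x) hB0
      rw [fk_eq hd0 hV' hK]
      refine (norm_add_le _ _).trans ?_
      rw [norm_one]
      have h2 : (2 : ℝ) ^ n / 2 ^ (m + 1) = 1 / 2 * (2 ^ n / 2 ^ m) := by
        rw [pow_succ]
        field_simp
      rw [h2]
      linarith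
  have hlim : Tendsto (fun m : ℕ => (2 : ℝ) + 2 ^ n / 2 ^ m) atTop (𝓝 (2 + 0)) := by
    refine tendsto_const_nhds.add ?_
    exact tendsto_const_nhds.div_atTop (tendsto_pow_atTop_atTop_of_one_lt (by norm_num))
  rw [add_zero] at hlim
  exact ge_of_tendsto' hlim fun m => key m n le_rfl x

/-- The Feynman–Kac equation `φ = 1 + G V φ`. -/
lemma feynman_kac {d : ℕ} (hd : 3 ≤ d) {K : Finset (Site d)} {c : ℝ} (hc : IsSmall K c)
    {V : Site d → ℂ} (hV : ∀ x, ‖V x‖ ≤ c) (hK : ∀ x, x ∉ K → V x = 0) {φ : Site d → ℂ}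
    (hφ : ∀ x, Tendsto (fun n => fk V n x) atTop (𝓝 (φ x))) (x : Site d) :
    φ x = 1 + ∑ y ∈ K, ((green x y).toReal : ℂ) * (V y * φ y) := by
  have hd0 : 0 < d := by omega
  have hV' : ∀ x, ‖V x‖ ≤ 1 / 2 := fun x => (hV x).trans hc.le_half
  refine tendsto_nhds_unique (hφ x) (Tendsto.congr (fun n => (fk_eq hd0 hV' hK n x).symm) ?_)
  refine tendsto_const_nhds.add ?_
  have h0 : ∀ n, ∑ k ∈ Finset.range n, ∑ y ∈ K,
      ((trans k x y).toReal : ℂ) * (V y * fk V (n - k) y) = ∑ y ∈ K, ∑ k ∈ Finset.range n,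
        ((trans k x y).toReal : ℂ) * (V y * fk V (n - k) y) := fun n => Finset.sum_comm
  simp only [h0]
  refine tendsto_finsetSum _ fun y _ => ?_
  -- Both the range and the summand move with `n`. Written as a series with a cutoff, the sum is
  -- handled by dominated convergence, with bound summable because the Green function is finite.
  have h1 : ∀ n, ∑ k ∈ Finset.range n, ((trans k x y).toReal : ℂ) * (V y * fk V (n - k) y) =
      ∑' k, if k < n then ((trans k x y).toReal : ℂ) * (V y * fk V (n - k) y) else 0 := by
    intro n
    rw [tsum_eq_sum (s := Finset.range n)]
    · exact Finset.sum_congr rfl fun k hk => by rw [if_pos (Finset.mem_range.1 hk)]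
    · intro k hk
      rw [if_neg (by simpa using hk)]
  have h2 : ((green x y).toReal : ℂ) * (V y * φ y) =
      ∑' k, ((trans k x y).toReal : ℂ) * (V y * φ y) := by
    rw [tsum_mul_right]
    congr 1
    rw [← (hasSum_toReal_trans hd x y).tsum_eq]
    push_cast
    rfl
  simp only [h1]
  rw [h2]
  refine tendsto_tsum_of_dominated_convergence (bound := fun k => (trans k x y).toReal * (c * 2))
    ((hasSum_toReal_trans hd x y).summable.mul_right _) ?_ ?_
  · intro k
    refine Tendsto.congr' (f₁ := fun n => ((trans k x y).toReal : ℂ) * (V y * fk V (n - k) y)) ?_ ?_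
    · filter_upwards [eventually_gt_atTop k] with n hn
      rw [if_pos hn]
    · exact ((((hφ y).comp (tendsto_sub_atTop_nat k))).const_mul _).const_mul _
  · refine Eventually.of_forall fun n k => ?_
    split_ifs
    · rw [norm_mul, norm_mul, Complex.norm_real, Real.norm_of_nonneg ENNReal.toReal_nonneg]
      exact mul_le_mul_of_nonneg_left
        (mul_le_mul (hV y) (norm_fk_le_two hd hc hV hK _ y) (norm_nonneg _) hc.pos.le)
        ENNReal.toReal_nonneg
    · rw [norm_zero]
      exact mul_nonneg ENNReal.toReal_nonneg (mul_nonneg hc.pos.le (by norm_num))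

/-! ### The equilibrium measure -/

lemma measurableSet_noReturn {d : ℕ} (K : Finset (Site d)) : MeasurableSet (noReturn K) := by
  have : noReturn K = ⋂ n : ℕ, ⋂ (_ : 1 ≤ n), ⋂ y ∈ K, {w : ℕ → Site d | w n = y}ᶜ := by
    ext w
    simp only [noReturn, Set.mem_ofPred_eq, Set.mem_iInter, Set.mem_compl_iff]
    exact ⟨fun h n hn y hy h' => h n hn (h' ▸ hy), fun h n hn hw => h n hn _ hw rfl⟩
  rw [this]
  exact MeasurableSet.iInter fun n => MeasurableSet.iInter fun _ => Finset.measurableSet_biInter _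
    fun y _ => (measurableSet_at n y).compl

/-- Decomposition at the last visit to `K`. -/
lemma sum_green_mul_equilibrium {d : ℕ} (hd : 3 ≤ d) {K : Finset (Site d)} {x : Site d}
    (hx : x ∈ K) : ∑ y ∈ K, green x y * equilibrium K y = 1 := by
  have hd0 : 0 < d := by omega
  have := isProbabilityMeasure_walkLaw hd0 x
  -- For `y ∈ K`, the event that the last visit to `K` takes place at time `n`, at the site `y`.
  set A : ℕ → Site d → Set (ℕ → Site d) :=
    fun n y => {w | w n = y ∧ (fun k => w (n + k)) ∈ noReturn K} with hA
  have hAm : ∀ n y, MeasurableSet (A n y) := fun n y =>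
    (measurableSet_at n y).inter
      ((by fun_prop : Measurable fun (w : ℕ → Site d) k => w (n + k)) (measurableSet_noReturn K))
  have h1 : ∀ y ∈ K, green x y * equilibrium K y = ∑' n, walkLaw x (A n y) := by
    intro y hy
    rw [equilibrium, if_pos hy, green_eq, ← ENNReal.tsum_mul_right]
    exact tsum_congr fun n => (walkLaw_markov hd0 (measurableSet_noReturn K) n x y).symm
  rw [Finset.sum_congr rfl h1, ← Summable.tsum_finsetSum fun _ _ => ENNReal.summable]
  have h2 : ∀ n, ∑ y ∈ K, walkLaw x (A n y) = walkLaw x (⋃ y ∈ K, A n y) := by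
    intro n
    rw [measure_biUnion_finset _ fun y _ => hAm n y]
    intro y _ z _ hyz
    exact Set.disjoint_left.2 fun w hw hw' => hyz (hw.1.symm.trans hw'.1)
  simp only [h2]
  rw [← measure_iUnion]
  · rw [← mem_ae_iff_prob_eq_one
      (MeasurableSet.iUnion fun n => Finset.measurableSet_biUnion _ fun y _ => hAm n y)]
    filter_upwards [walkLaw_start hd0 x, walkLaw_transient hd x] with w hw0 hw
    have hfin : {n | w n ∈ K}.Finite := by
      refine (K.finite_toSet.biUnion fun y _ => hw y).subset fun n hn => ?_
      exact Set.mem_biUnion hn rfl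
    have hne : hfin.toFinset.Nonempty := ⟨0, by simpa [hw0] using hx⟩
    set n := hfin.toFinset.max' hne with hn
    have hnK : w n ∈ K := by simpa using hfin.toFinset.max'_mem hne
    refine Set.mem_iUnion.2 ⟨n, Set.mem_biUnion hnK ⟨rfl, fun k hk hwk => ?_⟩⟩
    have := hfin.toFinset.le_max' (n + k) (by simpa using hwk)
    omega
  · intro m n hmn
    have key : ∀ {m n : ℕ}, m < n → Disjoint (⋃ y ∈ K, A m y) (⋃ y ∈ K, A n y) := by
      intro m n hlt
      refine Set.disjoint_left.2 fun w hw hw' => ?_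
      obtain ⟨y, hy, hwy⟩ := Set.mem_iUnion₂.1 hw
      obtain ⟨z, hz, hwz⟩ := Set.mem_iUnion₂.1 hw'
      refine hwy.2 (n - m) (by omega) ?_
      change w (m + (n - m)) ∈ K
      rw [Nat.add_sub_cancel' hlt.le, hwz.1]
      exact hz
    rcases lt_or_gt_of_ne hmn with h | h
    · exact key h
    · exact (key h).symm
  · exact fun n => Finset.measurableSet_biUnion _ fun y _ => hAm n y

lemma equilibrium_le_one {d : ℕ} (hd : 0 < d) (K : Finset (Site d)) (x : Site d) :
    equilibrium K x ≤ 1 := by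
  have := isProbabilityMeasure_walkLaw hd x
  rw [equilibrium]
  split_ifs
  · exact prob_le_one
  · exact zero_le_one

/-- The last-exit identity, transposed by symmetry of the Green function so that the equilibrium
measure acts on the starting point. -/
lemma sum_toReal_equilibrium_mul_green {d : ℕ} (hd : 3 ≤ d) {K : Finset (Site d)} {y : Site d}
    (hy : y ∈ K) : ∑ x ∈ K, (equilibrium K x).toReal * (green x y).toReal = 1 := by
  have hd0 : 0 < d := by omega
  have h := congrArg ENNReal.toReal (sum_green_mul_equilibrium hd hy)
  rw [ENNReal.toReal_sum fun x _ => ENNReal.mul_ne_top (green_ne_top hd y x)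
    ((equilibrium_le_one hd0 K x).trans_lt ENNReal.one_lt_top).ne] at h
  simpa [green_symm hd0 y, mul_comm] using h

/-! ### Exponential holding times -/

/-- The law of the holding times. -/
def holdLaw : Measure (ℤ → ℝ) := Measure.infinitePi fun _ : ℤ => expMeasure 1

instance isProbabilityMeasure_exp : IsProbabilityMeasure (expMeasure 1) :=
  isProbabilityMeasure_expMeasure one_pos

instance isProbabilityMeasure_holdLaw : IsProbabilityMeasure holdLaw := by
  unfold holdLaw
  infer_instance

lemma integral_exp_mul_expMeasure {z : ℂ} (hz : z.re < 1) :
    ∫ t : ℝ, Complex.exp (z * t) ∂expMeasure 1 = (1 - z)⁻¹ := by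
  have h : expMeasure 1 = volume.withDensity (exponentialPDF 1) := rfl
  have hm : Measurable (exponentialPDF 1) := (measurable_exponentialPDFReal 1).ennreal_ofReal
  rw [h, integral_withDensity_eq_integral_toReal_smul hm (ae_of_all _ fun _ => ENNReal.ofReal_lt_top)]
  have h1 : ∀ t : ℝ, (exponentialPDF 1 t).toReal • Complex.exp (z * t) =
      (Set.Ici (0 : ℝ)).indicator (fun t : ℝ => Complex.exp ((z - 1) * t)) t := by
    intro t
    rw [exponentialPDF_eq]
    by_cases ht : 0 ≤ t
    · rw [if_pos ht, Set.indicator_of_mem (Set.mem_Ici.2 ht),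
        ENNReal.toReal_ofReal (by positivity), Complex.real_smul]
      push_cast
      rw [one_mul, ← Complex.exp_add]
      congr 1
      ring
    · rw [if_neg ht, Set.indicator_of_notMem (by simpa using ht)]
      simp
  simp only [h1]
  have hz' : (z - 1).re < 0 := by
    rw [Complex.sub_re, Complex.one_re]
    linarith
  rw [integral_indicator measurableSet_Ici, integral_Ici_eq_integral_Ioi,
    integral_exp_mul_complex_Ioi hz']
  simp only [Complex.ofReal_zero, mul_zero, Complex.exp_zero]
  rw [← neg_sub z 1, inv_neg, neg_div, one_div]

lemma integral_exp_sum_holdLaw {n : ℕ} {a : ℕ → ℂ} (ha : ∀ k, (a k).re < 1) :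
    ∫ σ, Complex.exp (∑ k ∈ Finset.range n, a k * (σ k : ℂ)) ∂holdLaw =
      ∏ k ∈ Finset.range n, (1 - a k)⁻¹ := by
  have hind : iIndepFun (fun (i : Fin n) (σ : ℤ → ℝ) => σ (i : ℕ)) holdLaw :=
    (iIndepFun_infinitePi (P := fun _ : ℤ => expMeasure 1) (X := fun _ x => x)
      fun _ => measurable_id).precomp (g := fun i : Fin n => ((i : ℕ) : ℤ))
      fun i j h => Fin.ext (Nat.cast_injective h)
  have hm : ∀ i : Fin n, Measurable fun t : ℝ => Complex.exp (a i * t) := fun i => by fun_prop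
  have h := hind.integral_fun_prod_comp (f := fun (i : Fin n) (t : ℝ) => Complex.exp (a i * t))
    (fun i => (measurable_pi_apply _).aemeasurable) (fun i => (hm i).aestronglyMeasurable)
  have h2 : ∀ i : Fin n, ∫ σ, Complex.exp (a i * (σ (i : ℕ) : ℂ)) ∂holdLaw = (1 - a i)⁻¹ := by
    intro i
    rw [← integral_exp_mul_expMeasure (ha i),
      ← Measure.infinitePi_map_eval (fun _ : ℤ => expMeasure 1) ((i : ℕ) : ℤ),
      integral_map (measurable_pi_apply _).aemeasurable (hm i).aestronglyMeasurable]
    rfl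
  simp only [h2] at h
  rw [Finset.prod_range, ← h]
  refine integral_congr_ae (ae_of_all _ fun σ => ?_)
  simp only [Complex.exp_sum, Finset.prod_range]

lemma holdLaw_pos : ∀ᵐ σ ∂holdLaw, ∀ n, 0 < σ n := by
  rw [ae_all_iff]
  intro n
  have h : ∀ᵐ t ∂expMeasure 1, 0 < t := by
    have h0 : expMeasure 1 = volume.withDensity (exponentialPDF 1) := rfl
    have hm : Measurable (exponentialPDF 1) := (measurable_exponentialPDFReal 1).ennreal_ofReal
    rw [h0, ae_withDensity_iff hm]
    filter_upwards [compl_mem_ae_iff.2 (measure_singleton (μ := volume) (0 : ℝ))] with t ht h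
    by_contra hlt
    refine h (exponentialPDF_of_neg (lt_of_le_of_ne (not_lt.1 hlt) ?_))
    simpa using ht
  exact (measurePreserving_eval_infinitePi (fun _ : ℤ => expMeasure 1) n).quasiMeasurePreserving.ae h

lemma map_holdLaw {f : ℤ → ℤ} (hf : Function.Injective f) :
    holdLaw.map (fun σ i => σ (f i)) = holdLaw :=
  Measure.map_infinitePi_infinitePi_of_inj (P := fun _ : ℤ => expMeasure 1) hf

/-- A Chernoff bound: `exp(-S_n)` has mean `2⁻ⁿ`, so the total is at most `M` with probability at
most `e^M 2⁻ⁿ` for every `n`. -/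
lemma holdLaw_forward : ∀ᵐ σ ∂holdLaw, ∑' n : ℕ, ENNReal.ofReal (σ n) = ∞ := by
  set f : (ℤ → ℝ) → ℝ≥0∞ := fun σ => ∑' n : ℕ, ENNReal.ofReal (σ n) with hf
  have hfm : Measurable f := by fun_prop
  have key : ∀ M : ℕ, holdLaw {σ | f σ ≤ M} = 0 := by
    intro M
    have hn : ∀ n : ℕ, holdLaw {σ | f σ ≤ M} ≤
        ENNReal.ofReal (Real.exp M * (1 / 2) ^ n) := by
      intro n
      set g : (ℤ → ℝ) → ℝ := fun σ => Real.exp (-∑ k ∈ Finset.range n, σ k) with hg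
      have hgc : ∫ σ, (g σ : ℂ) ∂holdLaw = ((1 / 2 : ℝ) ^ n : ℝ) := by
        have h := integral_exp_sum_holdLaw (n := n) (a := fun _ => (-1 : ℂ)) (by simp)
        have e : ∀ σ : ℤ → ℝ, (g σ : ℂ) =
            Complex.exp (∑ k ∈ Finset.range n, (-1) * (σ k : ℂ)) := by
          intro σ
          simp [hg]
        simp only [e, h]
        rw [Finset.prod_const, Finset.card_range]
        push_cast
        norm_num
      have hgi : Integrable g holdLaw := by
        have : Integrable (fun σ => (g σ : ℂ)) holdLaw := by
          -- A non-integrable function has Bochner integral `0`, so a nonzero value certifies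
          -- integrability. The same device recurs below.
          refine Integrable.of_integral_ne_zero ?_
          rw [hgc]
          norm_num
        exact this.re
      have hgr : ∫ σ, g σ ∂holdLaw = (1 / 2) ^ n := by
        rw [integral_complex_ofReal] at hgc
        exact_mod_cast hgc
      have hsub : {σ | f σ ≤ M} ≤ᵐ[holdLaw]
          {σ | ENNReal.ofReal (Real.exp (-M)) ≤ ENNReal.ofReal (g σ)} := by
        filter_upwards [holdLaw_pos] with σ hσ hle
        refine ENNReal.ofReal_le_ofReal (Real.exp_le_exp.2 (neg_le_neg ?_))
        have h1 : ENNReal.ofReal (∑ k ∈ Finset.range n, σ k) ≤ M := by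
          rw [ENNReal.ofReal_sum_of_nonneg fun (k : ℕ) _ => (hσ k).le]
          exact (ENNReal.sum_le_tsum _).trans hle
        rw [← ENNReal.ofReal_natCast] at h1
        exact (ENNReal.ofReal_le_ofReal_iff (Nat.cast_nonneg M)).1 h1
      have h2 := mul_meas_ge_le_lintegral₀ (μ := holdLaw)
        (f := fun σ => ENNReal.ofReal (g σ)) hgi.1.aemeasurable.ennreal_ofReal
        (ENNReal.ofReal (Real.exp (-M)))
      rw [← ofReal_integral_eq_lintegral_ofReal hgi (ae_of_all _ fun σ => (Real.exp_pos _).le),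
        hgr] at h2
      calc holdLaw {σ | f σ ≤ M} ≤ _ := measure_mono_ae hsub
        _ = ENNReal.ofReal (Real.exp M) * (ENNReal.ofReal (Real.exp (-M)) * _) := by
            rw [← mul_assoc, ← ENNReal.ofReal_mul (Real.exp_pos _).le, ← Real.exp_add]
            simp
        _ ≤ ENNReal.ofReal (Real.exp M) * ENNReal.ofReal ((1 / 2) ^ n) := mul_le_mul_right h2 _
        _ = _ := by rw [← ENNReal.ofReal_mul (Real.exp_pos _).le]
    have hlim : Tendsto (fun n : ℕ => ENNReal.ofReal (Real.exp M * (1 / 2) ^ n)) atTop (𝓝 0) := by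
      have h0 := ((tendsto_pow_atTop_nhds_zero_of_lt_one (r := (1 / 2 : ℝ)) (by norm_num)
        (by norm_num)).const_mul (Real.exp M))
      rw [mul_zero] at h0
      simpa using ENNReal.tendsto_ofReal h0
    exact nonpos_iff_eq_zero.1 (ge_of_tendsto' hlim hn)
  have hall : ∀ᵐ σ ∂holdLaw, ∀ M : ℕ, ¬ f σ ≤ M := by
    rw [ae_all_iff]
    intro M
    rw [ae_iff]
    simpa using key M
  filter_upwards [hall] with σ hσ
  by_contra hne
  obtain ⟨M, hM⟩ := ENNReal.exists_nat_gt hne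
  exact hσ M hM.le

lemma holdLaw_backward : ∀ᵐ σ ∂holdLaw, ∑' n : ℕ, ENNReal.ofReal (σ (-(n : ℤ))) = ∞ := by
  have h := holdLaw_forward
  rw [← map_holdLaw neg_injective] at h
  exact ae_of_ae_map (measurable_pi_lambda _ fun i => measurable_pi_apply (-i)).aemeasurable h

/-- A consequence of Fatou's lemma. -/
lemma integrable_of_tendsto_of_integral_norm_le {α E : Type*} [MeasurableSpace α] {μ : Measure α}
    [NormedAddCommGroup E] {G : ℕ → α → E} {f : α → E}
    (hGf : ∀ᵐ x ∂μ, Tendsto (fun n => G n x) atTop (𝓝 (f x)))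
    (hG : ∀ n, Integrable (G n) μ) {B : ℝ} (hB : ∀ n, ∫ x, ‖G n x‖ ∂μ ≤ B) : Integrable f μ := by
  refine ⟨aestronglyMeasurable_of_tendsto_ae _ (fun n => (hG n).1) hGf, ?_⟩
  have h1 : ∫⁻ x, ‖f x‖ₑ ∂μ ≤ liminf (fun n => ∫⁻ x, ‖G n x‖ₑ ∂μ) atTop :=
    lintegral_congr_ae (by filter_upwards [hGf] with x hx using hx.enorm.liminf_eq) ▸
      lintegral_liminf_le' fun n => (hG n).1.enorm
  refine h1.trans_lt ((liminf_le_of_frequently_le' (Frequently.of_forall fun n => ?_)).trans_lt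
    (ENNReal.ofReal_lt_top (r := B)))
  rw [← ofReal_integral_norm_eq_lintegral_enorm (hG n)]
  exact ENNReal.ofReal_le_ofReal (hB n)

/-! ### Local times of the walk -/

/-- The time spent at `y` by the walk `p.1` with holding times `p.2`. -/
def walkTime {d : ℕ} (y : Site d) (p : (ℕ → Site d) × (ℤ → ℝ)) : ℝ≥0∞ :=
  ∑' k : ℕ, if p.1 k = y then ENNReal.ofReal (p.2 k) else 0

lemma measurable_walkTime {d : ℕ} (y : Site d) : Measurable (walkTime y) := by
  refine Measurable.tsum fun k => ?_
  refine Measurable.ite ?_ (by fun_prop) measurable_const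
  exact measurableSet_eq_fun (by fun_prop) measurable_const

/-- Exchange of the sum over sites with the sum over times, which is finite as `K` is not visited
from time `N` on. -/
lemma sum_mul_walkTime {d : ℕ} {K : Finset (Site d)} {V : Site d → ℂ} (hK : ∀ x, x ∉ K → V x = 0)
    {p : (ℕ → Site d) × (ℤ → ℝ)} (hp : ∀ n, 0 < p.2 n) {N : ℕ} (hN : ∀ k, N ≤ k → p.1 k ∉ K) :
    ∑ y ∈ K, V y * ((walkTime y p).toReal : ℂ) =
      ∑ k ∈ Finset.range N, V (p.1 k) * (p.2 k : ℂ) := by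
  have h1 : ∀ y ∈ K, V y * ((walkTime y p).toReal : ℂ) =
      ∑ k ∈ Finset.range N, if p.1 k = y then V (p.1 k) * (p.2 k : ℂ) else 0 := by
    intro y hy
    rw [walkTime, tsum_eq_sum (s := Finset.range N), ENNReal.toReal_sum, Complex.ofReal_sum,
      Finset.mul_sum]
    · refine Finset.sum_congr rfl fun k _ => ?_
      split_ifs with h
      · rw [ENNReal.toReal_ofReal (hp k).le, h]
      · simp
    · intro k _
      split_ifs <;> simp
    · intro k hk
      rw [if_neg]
      rintro rfl
      exact hN k (by simpa using hk) hy
  rw [Finset.sum_congr rfl h1, Finset.sum_comm]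
  refine Finset.sum_congr rfl fun k _ => ?_
  by_cases hk : p.1 k ∈ K
  · simp [hk]
  · simp [hK _ hk]

/-- The exponential of the potential accumulated along the first `n` steps. -/
def expPath {d : ℕ} (V : Site d → ℂ) (n : ℕ) (p : (ℕ → Site d) × (ℤ → ℝ)) : ℂ :=
  Complex.exp (∑ k ∈ Finset.range n, V (p.1 k) * (p.2 k : ℂ))

lemma measurable_expPath {d : ℕ} (V : Site d → ℂ) (n : ℕ) : Measurable (expPath V n) := by
  refine Complex.measurable_exp.comp (Finset.measurable_fun_sum _ fun k _ => ?_)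
  have h1 : Measurable fun p : (ℕ → Site d) × (ℤ → ℝ) => V (p.1 k) :=
    (Measurable.of_discrete (f := V)).comp (by fun_prop)
  have h2 : Measurable fun p : (ℕ → Site d) × (ℤ → ℝ) => (p.2 k : ℂ) := by fun_prop
  exact h1.mul h2

lemma integral_expPath_right {d : ℕ} {V : Site d → ℂ} (hV : ∀ x, ‖V x‖ ≤ 1 / 2) (n : ℕ)
    (w : ℕ → Site d) : ∫ σ, expPath V n (w, σ) ∂holdLaw = pathProd V n w := by
  simp only [expPath, pathProd]
  exact integral_exp_sum_holdLaw (a := fun k => V (w k)) fun k =>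
    ((Complex.re_le_norm _).trans (hV _)).trans_lt (by norm_num)

/-- The modulus of `expPath V` is `expPath` of the real part of `V`, whose average over holding
times is again a bounded `pathProd`. -/
lemma integrable_expPath {d : ℕ} (hd : 0 < d) {V : Site d → ℂ} (hV : ∀ x, ‖V x‖ ≤ 1 / 2) (n : ℕ)
    (x : Site d) : Integrable (expPath V n) ((walkLaw x).prod holdLaw) := by
  have := isProbabilityMeasure_walkLaw hd x
  have hne : ∀ z : ℂ, ‖z‖ ≤ 1 / 2 → (1 - z)⁻¹ ≠ 0 := fun z hz =>
    inv_ne_zero (norm_pos_iff.1 (by linarith [one_half_le_norm_one_sub hz]))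
  have hV' : ∀ x, ‖(((V x).re : ℝ) : ℂ)‖ ≤ 1 / 2 := fun x => by
    rw [Complex.norm_real]
    exact (Complex.abs_re_le_norm _).trans (hV x)
  rw [integrable_prod_iff (measurable_expPath V n).aestronglyMeasurable]
  refine ⟨ae_of_all _ fun w => Integrable.of_integral_ne_zero ?_, ?_⟩
  · rw [integral_expPath_right hV]
    exact Finset.prod_ne_zero_iff.2 fun k _ => hne _ (hV _)
  · have h1 : ∀ w, ∫ σ, ‖expPath V n (w, σ)‖ ∂holdLaw =
        ‖pathProd (fun y => (((V y).re : ℝ) : ℂ)) n w‖ := by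
      intro w
      have h2 := integral_expPath_right hV' n w
      have h3 : ∀ σ, expPath (fun y => (((V y).re : ℝ) : ℂ)) n (w, σ) =
          ((‖expPath V n (w, σ)‖ : ℝ) : ℂ) := by
        intro σ
        simp [expPath, Complex.norm_exp]
      simp only [h3] at h2
      rw [integral_complex_ofReal] at h2
      rw [← h2]
      exact ((Complex.norm_real _).trans
        (Real.norm_of_nonneg (integral_nonneg fun _ => norm_nonneg _))).symm
    simp only [h1]
    exact Integrable.of_bound (measurable_pathProd _ n).norm.aestronglyMeasurable (2 ^ n)
      (ae_of_all _ fun w => by rw [norm_norm]; exact norm_pathProd_le hV' n w)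

lemma integral_expPath {d : ℕ} (hd : 0 < d) {V : Site d → ℂ} (hV : ∀ x, ‖V x‖ ≤ 1 / 2) (n : ℕ)
    (x : Site d) : ∫ p, expPath V n p ∂((walkLaw x).prod holdLaw) = fk V n x := by
  have := isProbabilityMeasure_walkLaw hd x
  rw [integral_prod _ (integrable_expPath hd hV n x)]
  simp only [integral_expPath_right hV]
  rfl

/-- The exponential of the potential accumulated along the whole trajectory. -/
def expTotal {d : ℕ} (K : Finset (Site d)) (V : Site d → ℂ) (p : (ℕ → Site d) × (ℤ → ℝ)) : ℂ :=
  Complex.exp (∑ y ∈ K, V y * ((walkTime y p).toReal : ℂ))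

lemma measurable_expTotal {d : ℕ} (K : Finset (Site d)) (V : Site d → ℂ) :
    Measurable (expTotal K V) := by
  refine Complex.measurable_exp.comp (Finset.measurable_fun_sum _ fun y _ => ?_)
  exact (Complex.measurable_ofReal.comp (measurable_walkTime y).ennreal_toReal).const_mul _

/-- Nothing accumulates after the last visit to `K`. As `N` does not depend on `V`, a potential and
its dominating constant can be compared at the same time. -/
lemma exists_expPath_eq {d : ℕ} (hd : 3 ≤ d) (K : Finset (Site d)) (x : Site d) :
    ∀ᵐ p ∂((walkLaw x).prod holdLaw), (∀ n, 0 < p.2 n) ∧ ∃ N, ∀ n, N ≤ n →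
      ∀ V : Site d → ℂ, (∀ x, x ∉ K → V x = 0) → expTotal K V p = expPath V n p := by
  have := isProbabilityMeasure_walkLaw (show 0 < d by omega) x
  have h1 := Measure.quasiMeasurePreserving_fst (μ := walkLaw x) (ν := holdLaw) |>.ae
    (walkLaw_transient hd x)
  have h2 := Measure.quasiMeasurePreserving_snd (μ := walkLaw x) (ν := holdLaw) |>.ae holdLaw_pos
  filter_upwards [h1, h2] with p hp1 hp2
  refine ⟨hp2, ?_⟩
  have hfin : {n | p.1 n ∈ K}.Finite := by
    refine (K.finite_toSet.biUnion fun y _ => hp1 y).subset fun n hn => ?_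
    exact Set.mem_biUnion hn rfl
  obtain ⟨N, hN⟩ := hfin.bddAbove
  refine ⟨N + 1, fun n hn V hV => ?_⟩
  rw [expTotal, expPath, sum_mul_walkTime hV hp2 (N := n)]
  intro k hk hkK
  have := hN hkK
  omega

lemma tendsto_expPath {d : ℕ} (hd : 3 ≤ d) {K : Finset (Site d)} (x : Site d) {V : Site d → ℂ}
    (hK : ∀ x, x ∉ K → V x = 0) : ∀ᵐ p ∂((walkLaw x).prod holdLaw),
      Tendsto (fun n => expPath V n p) atTop (𝓝 (expTotal K V p)) := by
  filter_upwards [exists_expPath_eq hd K x] with p hp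
  obtain ⟨-, N, hN⟩ := hp
  refine tendsto_const_nhds.congr' ?_
  filter_upwards [eventually_ge_atTop N] with n hn
  exact hN n hn V hK

/-- The potential equal to `c` on `K`. -/
def constOn {d : ℕ} (K : Finset (Site d)) (c : ℝ) (x : Site d) : ℂ := if x ∈ K then c else 0

lemma constOn_of_notMem {d : ℕ} {K : Finset (Site d)} {c : ℝ} (x : Site d) (hx : x ∉ K) :
    constOn K c x = 0 := if_neg hx

lemma norm_constOn_le {d : ℕ} {K : Finset (Site d)} {c : ℝ} (hc : 0 ≤ c) (x : Site d) :
    ‖constOn K c x‖ ≤ c := by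
  rw [constOn]
  split_ifs
  · rw [Complex.norm_real, Real.norm_of_nonneg hc]
  · simpa using hc

/-- For a nonnegative potential `expPath` is its own modulus, so the bound on `fk` is a uniform `L¹`
bound and Fatou applies. -/
lemma integrable_expTotal_constOn {d : ℕ} (hd : 3 ≤ d) {K : Finset (Site d)} {c : ℝ}
    (hc : IsSmall K c) (x : Site d) :
    Integrable (expTotal K (constOn K c)) ((walkLaw x).prod holdLaw) := by
  have hd0 : 0 < d := by omega
  have hV' : ∀ x, ‖constOn K c x‖ ≤ 1 / 2 := fun x =>
    (norm_constOn_le hc.pos.le x).trans hc.le_half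
  refine integrable_of_tendsto_of_integral_norm_le (B := 2)
    (tendsto_expPath hd x constOn_of_notMem) (fun n => integrable_expPath hd0 hV' n x) fun n => ?_
  have h1 : ∀ p, expPath (constOn K c) n p = ((‖expPath (constOn K c) n p‖ : ℝ) : ℂ) := by
    intro p
    have h2 : ∑ k ∈ Finset.range n, constOn K c (p.1 k) * (p.2 k : ℂ) =
        ((∑ k ∈ Finset.range n, (if p.1 k ∈ K then c else 0) * p.2 k : ℝ) : ℂ) := by
      rw [Complex.ofReal_sum]
      refine Finset.sum_congr rfl fun k _ => ?_
      rw [constOn]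
      split_ifs <;> simp
    rw [expPath, h2, Complex.norm_exp, Complex.ofReal_re, Complex.ofReal_exp]
  have h3 := integral_expPath hd0 hV' n x
  rw [integral_congr_ae (ae_of_all _ h1), integral_complex_ofReal] at h3
  have h4 := norm_fk_le_two hd hc (norm_constOn_le hc.pos.le) constOn_of_notMem n x
  rw [← h3, Complex.norm_real] at h4
  exact (le_abs_self _).trans h4

lemma norm_expPath_le {d : ℕ} {K : Finset (Site d)} {c : ℝ} {V : Site d → ℂ}
    (hV : ∀ x, ‖V x‖ ≤ c) (hK : ∀ x, x ∉ K → V x = 0) {p : (ℕ → Site d) × (ℤ → ℝ)}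
    (hp : ∀ n, 0 < p.2 n) (n : ℕ) : ‖expPath V n p‖ ≤ ‖expPath (constOn K c) n p‖ := by
  rw [expPath, expPath, Complex.norm_exp, Complex.norm_exp, Real.exp_le_exp, Complex.re_sum,
    Complex.re_sum]
  refine Finset.sum_le_sum fun k _ => ?_
  rw [Complex.re_mul_ofReal, Complex.re_mul_ofReal]
  refine mul_le_mul_of_nonneg_right ?_ (hp k).le
  rw [constOn]
  split_ifs with h
  · exact (Complex.re_le_norm _).trans (hV _)
  · rw [hK _ h]

lemma monotone_norm_expPath_constOn {d : ℕ} {K : Finset (Site d)} {c : ℝ} (hc : 0 ≤ c)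
    {p : (ℕ → Site d) × (ℤ → ℝ)} (hp : ∀ n, 0 < p.2 n) :
    Monotone fun n => ‖expPath (constOn K c) n p‖ := by
  intro m n hmn
  simp only [expPath, Complex.norm_exp, Complex.re_sum, Complex.re_mul_ofReal]
  refine Real.exp_le_exp.2 (Finset.sum_le_sum_of_subset_of_nonneg
    (Finset.range_subset_range.2 hmn) fun k _ _ => mul_nonneg ?_ (hp k).le)
  rw [constOn]
  split_ifs
  · simpa using hc
  · simp

lemma integrable_expTotal {d : ℕ} (hd : 3 ≤ d) {K : Finset (Site d)} {c : ℝ} (hc : IsSmall K c)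
    {V : Site d → ℂ} (hV : ∀ x, ‖V x‖ ≤ c) (hK : ∀ x, x ∉ K → V x = 0) (x : Site d) :
    Integrable (expTotal K V) ((walkLaw x).prod holdLaw) := by
  refine (integrable_expTotal_constOn hd hc x).mono (measurable_expTotal K V).aestronglyMeasurable ?_
  filter_upwards [exists_expPath_eq hd K x] with p hp
  obtain ⟨hp, N, hN⟩ := hp
  rw [hN N le_rfl V hK, hN N le_rfl _ constOn_of_notMem]
  exact norm_expPath_le hV hK hp N

/-- Dominated convergence: for the constant potential the modulus increases with `n`, so its
terminal value dominates every `expPath V n`. -/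
lemma tendsto_fk {d : ℕ} (hd : 3 ≤ d) {K : Finset (Site d)} {c : ℝ} (hc : IsSmall K c)
    {V : Site d → ℂ} (hV : ∀ x, ‖V x‖ ≤ c) (hK : ∀ x, x ∉ K → V x = 0) (x : Site d) :
    Tendsto (fun n => fk V n x) atTop (𝓝 (∫ p, expTotal K V p ∂((walkLaw x).prod holdLaw))) := by
  have hd0 : 0 < d := by omega
  have hV' : ∀ x, ‖V x‖ ≤ 1 / 2 := fun x => (hV x).trans hc.le_half
  simp only [← integral_expPath hd0 hV']
  refine tendsto_integral_of_dominated_convergence (fun p => ‖expTotal K (constOn K c) p‖)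
    (fun n => (measurable_expPath V n).aestronglyMeasurable)
    (integrable_expTotal_constOn hd hc x).norm (fun n => ?_) (tendsto_expPath hd x hK)
  filter_upwards [exists_expPath_eq hd K x] with p hp
  obtain ⟨hp, N, hN⟩ := hp
  rw [hN (max N n) (le_max_left _ _) _ constOn_of_notMem]
  exact (norm_expPath_le hV hK hp n).trans
    (monotone_norm_expPath_constOn hc.pos.le hp (le_max_right _ _))

/-! ### The exponential functional of a Poisson point process -/

namespace IsPoisson

variable {Ω E : Type*} [MeasurableSpace Ω] [MeasurableSpace E] {P : Measure Ω}
  {N : Ω → Measure E} {m : Measure E}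

lemma measurable_apply (hN : IsPoisson P N m) {A : Set E} (hA : MeasurableSet A) :
    Measurable fun ω => N ω A :=
  (Measure.measurable_coe hA).comp hN.measurable

lemma ae_ne_top (hN : IsPoisson P N m) {A : Set E} (hA : MeasurableSet A) (hmA : m A ≠ ∞) :
    ∀ᵐ ω ∂P, N ω A ≠ ∞ := by
  have h : ∀ᵐ r ∂P.map fun ω => N ω A, r ≠ ∞ := by
    have hmeas : MeasurableSet {r : ℝ≥0∞ | r ≠ ∞} := (measurableSet_singleton ∞).compl
    rw [hN.law A hA hmA, ae_map_iff Measurable.of_discrete.aemeasurable hmeas]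
    exact ae_of_all _ fun n => ENNReal.natCast_ne_top n
  exact ae_of_ae_map (hN.measurable_apply hA).aemeasurable h

lemma integral_exp_apply (hN : IsPoisson P N m) {A : Set E} (hA : MeasurableSet A) (hmA : m A ≠ ∞)
    (v : ℂ) : ∫ ω, Complex.exp (v * ((N ω A).toReal : ℂ)) ∂P =
      Complex.exp (((m A).toReal : ℂ) * (Complex.exp v - 1)) := by
  have hf : Measurable fun r : ℝ≥0∞ => Complex.exp (v * (r.toReal : ℂ)) := by fun_prop
  have h1 : ∫ ω, Complex.exp (v * ((N ω A).toReal : ℂ)) ∂P =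
      ∫ r, Complex.exp (v * (r.toReal : ℂ)) ∂(P.map fun ω => N ω A) :=
    (integral_map (hN.measurable_apply hA).aemeasurable hf.aestronglyMeasurable).symm
  rw [h1, hN.law A hA hmA, integral_map Measurable.of_discrete.aemeasurable hf.aestronglyMeasurable,
    integral_poissonMeasure]
  set r : ℝ := (m A).toReal with hr
  have hr' : (((m A).toNNReal : NNReal) : ℝ) = r := rfl
  have h2 : ∀ n : ℕ, (Real.exp (-((m A).toNNReal : ℝ)) * ((m A).toNNReal : ℝ) ^ n /
      (n.factorial : ℝ)) • Complex.exp (v * (((n : ℝ≥0∞).toReal : ℝ) : ℂ)) =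
      Complex.exp (-r) * ((r * Complex.exp v) ^ n / (n.factorial : ℂ)) := by
    intro n
    rw [hr', Complex.real_smul, mul_pow, ← Complex.exp_nat_mul, ENNReal.toReal_natCast]
    push_cast
    rw [mul_comm v]
    ring
  simp only [h2]
  rw [tsum_mul_left]
  have h3 := congrFun (NormedSpace.exp_eq_tsum_div (𝔸 := ℂ)) (r * Complex.exp v)
  rw [← Complex.exp_eq_exp_ℂ] at h3
  rw [← h3, ← Complex.exp_add]
  congr 1
  ring

/-- The exponential formula for a simple function. -/
lemma integral_exp_simple (hN : IsPoisson P N m) {β : Type*} (s : SimpleFunc E β) (R : Finset β)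
    (hR : ∀ b ∈ R, m (s ⁻¹' {b}) ≠ ∞) (v : β → ℂ) (hv : ∀ e, s e ∉ R → v (s e) = 0) :
    ∫ ω, Complex.exp (∑ b ∈ R, v b * ((N ω (s ⁻¹' {b})).toReal : ℂ)) ∂P =
      Complex.exp (∫ e, (Complex.exp (v (s e)) - 1) ∂m) := by
  have hmeas : ∀ b, MeasurableSet (s ⁻¹' {b}) := fun b => s.measurableSet_fiber b
  -- Distinct values have disjoint fibres, whose counts are independent; the expectation factors
  -- into Poisson Laplace transforms.
  have hind := hN.indep R.card (fun i => s ⁻¹' {(R.equivFin.symm i : β)}) (fun i => hmeas _) (by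
    intro i j hij
    refine Set.disjoint_left.2 fun e hi hj => hij ?_
    have : (R.equivFin.symm i : β) = R.equivFin.symm j := hi.symm.trans hj
    exact R.equivFin.symm.injective (Subtype.ext this))
  have hsum : ∀ f : β → ℂ, ∑ b ∈ R, f b = ∑ i, f (R.equivFin.symm i) := by
    intro f
    rw [← Finset.sum_coe_sort R f]
    exact (R.equivFin.symm.sum_comp fun b : R => f b).symm
  have hm : ∀ z : ℂ, Measurable fun r : ℝ≥0∞ => Complex.exp (z * (r.toReal : ℂ)) := fun z => by
    fun_prop
  have h1 := hind.integral_fun_prod_comp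
    (f := fun i (r : ℝ≥0∞) => Complex.exp (v (R.equivFin.symm i) * (r.toReal : ℂ)))
    (fun i => (hN.measurable_apply (hmeas _)).aemeasurable)
    (fun i => (hm _).aestronglyMeasurable)
  simp only [← Complex.exp_sum] at h1
  simp only [hsum]
  rw [h1]
  have h2 : ∀ i, ∫ ω, Complex.exp (v (R.equivFin.symm i) *
      ((N ω (s ⁻¹' {(R.equivFin.symm i : β)})).toReal : ℂ)) ∂P =
      Complex.exp (((m (s ⁻¹' {(R.equivFin.symm i : β)})).toReal : ℂ) *
        (Complex.exp (v (R.equivFin.symm i)) - 1)) := fun i =>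
    hN.integral_exp_apply (hmeas _) (hR _ (R.equivFin.symm i).2) _
  simp only [h2]
  rw [← Complex.exp_sum, ← hsum fun b => ((m (s ⁻¹' {b})).toReal : ℂ) * (Complex.exp (v b) - 1)]
  congr 1
  have h3 : ∀ e, Complex.exp (v (s e)) - 1 =
      ∑ b ∈ R, (s ⁻¹' {b}).indicator (fun _ => Complex.exp (v b) - 1) e := by
    intro e
    by_cases he : s e ∈ R
    · rw [Finset.sum_eq_single_of_mem _ he]
      · rw [Set.indicator_of_mem (by simp)]
      · intro b _ hb
        exact Set.indicator_of_notMem (by simpa using hb.symm) _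
    · rw [hv e he, Complex.exp_zero, sub_self]
      refine (Finset.sum_eq_zero fun b hb => Set.indicator_of_notMem ?_ _).symm
      rintro rfl
      exact he hb
  simp only [h3]
  rw [integral_finsetSum R fun b hb =>
    (integrable_indicator_iff (hmeas b)).2 (integrableOn_const (hR b hb))]
  refine Finset.sum_congr rfl fun b _ => ?_
  rw [integral_indicator_const _ (hmeas b), Complex.real_smul]
  rfl

end IsPoisson

/-- A finite family of simple functions as a simple function into the product. -/
def simplePi {E ι γ : Type*} [MeasurableSpace E] [Fintype ι] (s : ι → SimpleFunc E γ) :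
    SimpleFunc E (ι → γ) where
  toFun e i := s i e
  measurableSet_fiber' b := by
    have : (fun e i => s i e) ⁻¹' {b} = ⋂ i, s i ⁻¹' {b i} := by
      ext e
      simp [funext_iff]
    rw [this]
    exact MeasurableSet.iInter fun i => (s i).measurableSet_fiber _
  finite_range' := by
    refine (Set.Finite.pi' fun i => (s i).finite_range).subset ?_
    rintro _ ⟨e, rfl⟩ i
    exact ⟨e, rfl⟩

namespace IsPoisson

variable {Ω E : Type*} [MeasurableSpace Ω] [MeasurableSpace E] {P : Measure Ω}
  {N : Ω → Measure E} {m : Measure E}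

/-- The exponential formula for a finite family of simple functions. -/
lemma integral_exp_simple_family (hN : IsPoisson P N m) {ι : Type*} [Fintype ι]
    (s : ι → SimpleFunc E ℝ≥0∞) (hs : ∀ i e, s i e ≠ ∞) {A : Set E} (hA : MeasurableSet A)
    (hmA : m A ≠ ∞) (hsA : ∀ i, ∀ e, e ∉ A → s i e = 0) :
    (∀ᵐ ω ∂P, ∀ i, ∫⁻ e, s i e ∂N ω ≠ ∞) ∧ ∀ V : ι → ℂ,
      ∫ ω, Complex.exp (∑ i, V i * ((∫⁻ e, s i e ∂N ω).toReal : ℂ)) ∂P =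
        Complex.exp (∫ e, (Complex.exp (∑ i, V i * ((s i e).toReal : ℂ)) - 1) ∂m) := by
  classical
  set S := simplePi s with hS
  -- The fibre over `0` may have infinite mass but contributes nothing; the other fibres lie in `A`.
  set R : Finset (ι → ℝ≥0∞) := S.range.filter (· ≠ 0) with hR
  have hsub : ∀ b ∈ R, S ⁻¹' {b} ⊆ A := by
    intro b hb e he
    by_contra heA
    refine (Finset.mem_filter.1 hb).2 ?_
    rw [← Set.mem_singleton_iff.1 he]
    funext i
    exact hsA i e heA
  have hNA := hN.ae_ne_top hA hmA
  have hlin : ∀ ω i, ∫⁻ e, s i e ∂N ω = ∑ b ∈ R, b i * N ω (S ⁻¹' {b}) := by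
    intro ω i
    have h1 : ∫⁻ e, s i e ∂N ω = (S.map fun b => b i).lintegral (N ω) := by
      rw [← SimpleFunc.lintegral_eq_lintegral]
      rfl
    rw [h1, SimpleFunc.map_lintegral, hR, Finset.sum_filter]
    refine Finset.sum_congr rfl fun b _ => ?_
    split_ifs with hb
    · rfl
    · rw [not_not.1 hb]
      simp
  have hbi : ∀ b ∈ R, ∀ i, b i ≠ ∞ := by
    intro b hb i
    obtain ⟨e, rfl⟩ := SimpleFunc.mem_range.1 (Finset.mem_filter.1 hb).1
    exact hs i e
  have hterm : ∀ᵐ ω ∂P, ∀ b ∈ R, N ω (S ⁻¹' {b}) ≠ ∞ := by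
    filter_upwards [hNA] with ω hω b hb
    exact ((measure_mono (hsub b hb)).trans_lt hω.lt_top).ne
  constructor
  · filter_upwards [hterm] with ω hω i
    rw [hlin]
    exact (ENNReal.sum_lt_top.2 fun b hb =>
      (ENNReal.mul_ne_top (hbi b hb i) (hω b hb)).lt_top).ne
  · intro V
    set v : (ι → ℝ≥0∞) → ℂ := fun b => ∑ i, V i * ((b i).toReal : ℂ) with hv
    have h := hN.integral_exp_simple S R
      (fun b hb => ((measure_mono (hsub b hb)).trans_lt hmA.lt_top).ne) v (by
        intro e he
        have : S e = 0 := by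
          by_contra h0
          exact he (Finset.mem_filter.2 ⟨SimpleFunc.mem_range_self S e, h0⟩)
        rw [this]
        simp [hv])
    refine Eq.trans (integral_congr_ae ?_) h
    filter_upwards [hterm] with ω hω
    congr 1
    have h1 : ∀ i, ((∫⁻ e, s i e ∂N ω).toReal : ℂ) =
        ∑ b ∈ R, ((b i).toReal : ℂ) * ((N ω (S ⁻¹' {b})).toReal : ℂ) := by
      intro i
      rw [hlin, ENNReal.toReal_sum fun b hb => ENNReal.mul_ne_top (hbi b hb i) (hω b hb)]
      push_cast
      simp only [ENNReal.toReal_mul]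
      push_cast
      rfl
    simp only [h1, hv, Finset.mul_sum, Finset.sum_mul]
    rw [Finset.sum_comm]
    simp only [mul_assoc]

/-- The exponential formula for a Poisson point process. -/
theorem exponential_formula (hN : IsPoisson P N m) {ι : Type*} [Fintype ι] {F : ι → E → ℝ≥0∞}
    (hF : ∀ i, Measurable (F i)) (hFtop : ∀ i e, F i e ≠ ∞) {A : Set E} (hA : MeasurableSet A)
    (hmA : m A ≠ ∞) (hFA : ∀ i, ∀ e, e ∉ A → F i e = 0) {c : ℝ} (hc : 0 < c)
    (hint : Integrable (fun e => Real.exp (c * ∑ i, (F i e).toReal)) (m.restrict A)) :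
    (∀ᵐ ω ∂P, ∀ i, ∫⁻ e, F i e ∂N ω ≠ ∞) ∧ ∀ V : ι → ℂ, (∀ i, ‖V i‖ ≤ c) →
      Integrable (fun ω => Complex.exp (∑ i, V i * ((∫⁻ e, F i e ∂N ω).toReal : ℂ))) P ∧
      ∫ ω, Complex.exp (∑ i, V i * ((∫⁻ e, F i e ∂N ω).toReal : ℂ)) ∂P =
        Complex.exp (∫ e, (Complex.exp (∑ i, V i * ((F i e).toReal : ℂ)) - 1) ∂m) := by
  set s : ℕ → ι → SimpleFunc E ℝ≥0∞ := fun n i => SimpleFunc.eapprox (F i) n with hs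
  have hs_ne_top : ∀ n i e, s n i e ≠ ∞ := fun n i e => (SimpleFunc.eapprox_lt_top (F i) n e).ne
  have hsF : ∀ n i e, s n i e ≤ F i e := fun n i e => by
    rw [← SimpleFunc.iSup_eapprox_apply (hF i) e]
    exact le_iSup (fun n => SimpleFunc.eapprox (F i) n e) n
  have hsA : ∀ n i e, e ∉ A → s n i e = 0 := fun n i e he =>
    nonpos_iff_eq_zero.1 ((hsF n i e).trans (hFA i e he).le)
  have hslim : ∀ i e, Tendsto (fun n => s n i e) atTop (𝓝 (F i e)) := fun i e =>
    SimpleFunc.tendsto_eapprox (hF i) e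
  have hsim := fun n => hN.integral_exp_simple_family (s n) (hs_ne_top n) hA hmA (hsA n)
  set L : ℕ → ι → Ω → ℝ≥0∞ := fun n i ω => ∫⁻ e, s n i e ∂N ω with hL
  set T : ι → Ω → ℝ≥0∞ := fun i ω => ∫⁻ e, F i e ∂N ω with hT
  have hLm : ∀ n i, Measurable (L n i) := fun n i =>
    (Measure.measurable_lintegral (s n i).measurable).comp hN.measurable
  have hTm : ∀ i, Measurable (T i) := fun i =>
    (Measure.measurable_lintegral (hF i)).comp hN.measurable
  have hLT : ∀ n i ω, L n i ω ≤ T i ω := fun n i ω => lintegral_mono fun e => hsF n i e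
  have hLlim : ∀ i ω, Tendsto (fun n => L n i ω) atTop (𝓝 (T i ω)) := fun i ω =>
    lintegral_tendsto_of_tendsto_of_monotone (fun n => (s n i).measurable.aemeasurable)
      (ae_of_all _ fun e n k hnk => SimpleFunc.monotone_eapprox (F i) hnk e)
      (ae_of_all _ fun e => hslim i e)
  have hLfin : ∀ᵐ ω ∂P, ∀ n i, L n i ω ≠ ∞ := ae_all_iff.2 fun n => (hsim n).1
  -- The factor `2` accounts for the `-1` in the integrand, as the exponential is at least `1`.
  set D : E → ℝ := fun e => 2 * Real.exp (c * ∑ i, (F i e).toReal) with hD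
  have hDint : Integrable D (m.restrict A) := hint.const_mul 2
  -- pointwise bounds for the exponentials
  have hexp : ∀ (a : ι → ℝ≥0∞) (b : ι → ℝ≥0∞) (V : ι → ℂ), (∀ i, ‖V i‖ ≤ c) → (∀ i, a i ≤ b i) →
      (∀ i, b i ≠ ∞) → ‖Complex.exp (∑ i, V i * ((a i).toReal : ℂ))‖ ≤
        Real.exp (c * ∑ i, (b i).toReal) := by
    intro a b V hV hab hb
    rw [Complex.norm_exp, Complex.re_sum, Finset.mul_sum]
    refine Real.exp_le_exp.2 (Finset.sum_le_sum fun i _ => ?_)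
    rw [Complex.re_mul_ofReal]
    exact mul_le_mul ((Complex.re_le_norm _).trans (hV i)) (ENNReal.toReal_mono (hb i) (hab i))
      ENNReal.toReal_nonneg hc.le
  have hexp1 : ∀ n e (V : ι → ℂ), (∀ i, ‖V i‖ ≤ c) →
      ‖Complex.exp (∑ i, V i * ((s n i e).toReal : ℂ)) - 1‖ ≤ D e := by
    intro n e V hV
    refine (norm_sub_le _ _).trans ?_
    have h1 := hexp (fun i => s n i e) (fun i => F i e) V hV (fun i => hsF n i e)
      (fun i => hFtop i e)
    have h2 : 1 ≤ Real.exp (c * ∑ i, (F i e).toReal) := Real.one_le_exp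
      (mul_nonneg hc.le (Finset.sum_nonneg fun i _ => ENNReal.toReal_nonneg))
    rw [norm_one]
    simp only [hD]
    linarith
  have hrestrict : ∀ (f : ι → E → ℝ≥0∞), (∀ i e, e ∉ A → f i e = 0) → ∀ V : ι → ℂ,
      ∫ e, (Complex.exp (∑ i, V i * ((f i e).toReal : ℂ)) - 1) ∂m =
        ∫ e in A, (Complex.exp (∑ i, V i * ((f i e).toReal : ℂ)) - 1) ∂m := by
    intro f hf V
    refine (setIntegral_eq_integral_of_forall_compl_eq_zero fun e he => ?_).symm
    simp [hf _ e he]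
  set G : (ι → ℂ) → ℕ → Ω → ℂ :=
    fun V n ω => Complex.exp (∑ i, V i * ((L n i ω).toReal : ℂ)) with hG
  have hGm : ∀ V n, Measurable (G V n) := by
    intro V n
    refine Complex.measurable_exp.comp (Finset.measurable_fun_sum _ fun i _ => ?_)
    exact (Complex.measurable_ofReal.comp (hLm n i).ennreal_toReal).const_mul _
  have hGint : ∀ V n, ∫ ω, G V n ω ∂P = Complex.exp (∫ e in A,
      (Complex.exp (∑ i, V i * ((s n i e).toReal : ℂ)) - 1) ∂m) := by
    intro V n
    rw [← hrestrict _ (hsA n)]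
    exact (hsim n).2 V
  have hGi : ∀ V n, Integrable (G V n) P := fun V n =>
    Integrable.of_integral_ne_zero (by rw [hGint]; exact Complex.exp_ne_zero _)
  -- uniform bound in the real case
  set Vc : ι → ℂ := fun _ => (c : ℂ) with hVc
  have hVcn : ∀ i, ‖Vc i‖ ≤ c := fun i => by
    simp only [hVc, Complex.norm_real, Real.norm_of_nonneg hc.le, le_refl]
  have hGc : ∀ n ω, ‖G Vc n ω‖ = Real.exp (c * ∑ i, (L n i ω).toReal) := by
    intro n ω
    simp only [hG, hVc]
    rw [← Finset.mul_sum, ← Complex.ofReal_sum, ← Complex.ofReal_mul, Complex.norm_exp,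
      Complex.ofReal_re]
  set B : ℝ := Real.exp (∫ e in A, D e ∂m) with hB
  have hGB : ∀ n, ∫ ω, ‖G Vc n ω‖ ∂P ≤ B := by
    intro n
    have h1 : ∀ ω, G Vc n ω = ((‖G Vc n ω‖ : ℝ) : ℂ) := by
      intro ω
      rw [hGc]
      simp only [hG, hVc]
      rw [← Finset.mul_sum]
      push_cast
      rfl
    have h2 := hGint Vc n
    rw [integral_congr_ae (ae_of_all _ h1), integral_complex_ofReal] at h2
    have h3 := congrArg norm h2
    rw [Complex.norm_real, Complex.norm_exp] at h3
    refine (le_abs_self _).trans (h3.trans_le (Real.exp_le_exp.2 ?_))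
    refine (Complex.re_le_norm _).trans ?_
    exact norm_integral_le_of_norm_le hDint (ae_of_all _ fun e => hexp1 n e Vc hVcn)
  -- finiteness
  have hfin : ∀ᵐ ω ∂P, ∀ i, T i ω ≠ ∞ := by
    -- By Fatou the liminf is almost surely finite, so the approximations `L n i` are bounded along
    -- a subsequence, and so is their limit. Finiteness must come before the convergence of
    -- exponentials, since `toReal` sends `∞` to `0`.
    have h1 : ∫⁻ ω, liminf (fun n => ‖G Vc n ω‖ₑ) atTop ∂P < ∞ := by
      refine (lintegral_liminf_le fun n => (hGm Vc n).enorm).trans_lt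
        ((liminf_le_of_frequently_le' (Frequently.of_forall fun n => ?_)).trans_lt
          (ENNReal.ofReal_lt_top (r := B)))
      rw [← ofReal_integral_norm_eq_lintegral_enorm (hGi Vc n)]
      exact ENNReal.ofReal_le_ofReal (hGB n)
    have h2 := ae_lt_top (Measurable.liminf fun n => (hGm Vc n).enorm) h1.ne
    filter_upwards [h2, hLfin] with ω hω hLω i
    obtain ⟨C, hC⟩ := ENNReal.exists_nat_gt hω.ne
    have hfreq := frequently_lt_of_liminf_lt (by isBoundedDefault) hC
    have h3 : ∃ᶠ n in atTop, L n i ω ∈ Set.Iic (ENNReal.ofReal (C / c)) := by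
      refine hfreq.mono fun n hn => ?_
      have h4 : Real.exp (c * ∑ i, (L n i ω).toReal) < C := by
        rw [← hGc]
        rw [← ofReal_norm, ← ENNReal.ofReal_natCast] at hn
        exact (ENNReal.ofReal_lt_ofReal_iff_of_nonneg (norm_nonneg _)).1 hn
      have h5 : (L n i ω).toReal ≤ ∑ i, (L n i ω).toReal :=
        Finset.single_le_sum (f := fun i => (L n i ω).toReal) (fun i _ => ENNReal.toReal_nonneg)
          (Finset.mem_univ i)
      have h6 := Real.add_one_le_exp (c * ∑ i, (L n i ω).toReal)
      rw [Set.mem_Iic, ← ENNReal.ofReal_toReal (hLω n i)]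
      refine ENNReal.ofReal_le_ofReal ?_
      rw [le_div_iff₀ hc]
      nlinarith
    have h7 := isClosed_Iic.mem_of_frequently_of_tendsto h3 (hLlim i ω)
    exact (lt_of_le_of_lt h7 ENNReal.ofReal_lt_top).ne
  refine ⟨hfin, fun V hV => ?_⟩
  set H : (ι → ℂ) → Ω → ℂ := fun V ω => Complex.exp (∑ i, V i * ((T i ω).toReal : ℂ)) with hH
  have hHm : ∀ V, Measurable (H V) := by
    intro V
    refine Complex.measurable_exp.comp (Finset.measurable_fun_sum _ fun i _ => ?_)
    exact (Complex.measurable_ofReal.comp (hTm i).ennreal_toReal).const_mul _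
  have hGH : ∀ V, ∀ᵐ ω ∂P, Tendsto (fun n => G V n ω) atTop (𝓝 (H V ω)) := by
    intro V
    filter_upwards [hfin] with ω hω
    refine (Complex.continuous_exp.tendsto _).comp (tendsto_finsetSum _ fun i _ => ?_)
    exact ((Complex.continuous_ofReal.tendsto _).comp
      ((ENNReal.tendsto_toReal (hω i)).comp (hLlim i ω))).const_mul _
  have hHc : Integrable (H Vc) P :=
    integrable_of_tendsto_of_integral_norm_le (hGH Vc) (hGi Vc) hGB
  have hHcn : ∀ ω, ‖H Vc ω‖ = Real.exp (c * ∑ i, (T i ω).toReal) := by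
    intro ω
    simp only [hH, hVc]
    rw [← Finset.mul_sum, ← Complex.ofReal_sum, ← Complex.ofReal_mul, Complex.norm_exp,
      Complex.ofReal_re]
  have hGbound : ∀ n, ∀ᵐ ω ∂P, ‖G V n ω‖ ≤ ‖H Vc ω‖ := by
    intro n
    filter_upwards [hfin] with ω hω
    rw [hHcn]
    exact hexp _ _ V hV (fun i => hLT n i ω) hω
  have hHbound : ∀ᵐ ω ∂P, ‖H V ω‖ ≤ ‖H Vc ω‖ := by
    filter_upwards [hfin] with ω hω
    rw [hHcn]
    exact hexp _ _ V hV (fun i => le_rfl) hω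
  refine ⟨hHc.mono (hHm V).aestronglyMeasurable hHbound, ?_⟩
  have hleft : Tendsto (fun n => ∫ ω, G V n ω ∂P) atTop (𝓝 (∫ ω, H V ω ∂P)) :=
    tendsto_integral_of_dominated_convergence _ (fun n => (hGm V n).aestronglyMeasurable) hHc.norm
      hGbound (hGH V)
  refine tendsto_nhds_unique hleft ?_
  simp only [hGint]
  rw [hrestrict _ hFA]
  refine (Complex.continuous_exp.tendsto _).comp ?_
  refine tendsto_integral_of_dominated_convergence D (fun n => ?_) hDint
    (fun n => ae_of_all _ fun e => hexp1 n e V hV) (ae_of_all _ fun e => ?_)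
  · refine Measurable.aestronglyMeasurable (Measurable.sub_const ?_ 1)
    refine Complex.measurable_exp.comp (Finset.measurable_fun_sum _ fun i _ => ?_)
    exact (Complex.measurable_ofReal.comp (s n i).measurable.ennreal_toReal).const_mul _
  · refine Tendsto.sub_const ?_ 1
    refine (Complex.continuous_exp.tendsto _).comp (tendsto_finsetSum _ fun i _ => ?_)
    exact ((Complex.continuous_ofReal.tendsto _).comp
      ((ENNReal.tendsto_toReal (hFtop i e)).comp (hslim i e))).const_mul _

end IsPoisson

/-! ### The entrance measure -/

/-- Finiteness of a set of times is rewritten as boundedness by some natural number, a countable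
condition. Measurability makes the inclusion of `Traj d` a measurable embedding, through which the
`comap` in `entranceMeasure` is computed. -/
lemma measurableSet_isTrajectory (d : ℕ) : MeasurableSet {w : ℤ → Site d × ℝ | IsTrajectory w} := by
  have h : {w : ℤ → Site d × ℝ | IsTrajectory w} =
      (⋂ n : ℤ, {w | l1 ((w (n + 1)).1 - (w n).1) = 1}) ∩
      (⋂ y : Site d, ⋃ N : ℕ, ⋂ n : ℤ, ⋂ (_ : (N : ℤ) < |n|), {w | (w n).1 = y}ᶜ) ∩
      (⋂ n : ℤ, {w | 0 < (w n).2}) ∩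
      {w | ∑' n : ℕ, ENNReal.ofReal (w (n : ℤ)).2 = ∞} ∩
      {w | ∑' n : ℕ, ENNReal.ofReal (w (-(n : ℤ))).2 = ∞} := by
    ext w
    have hfin : ∀ y : Site d, {n | (w n).1 = y}.Finite ↔
        ∃ N : ℕ, ∀ n : ℤ, (N : ℤ) < |n| → ¬ (w n).1 = y := by
      intro y
      constructor
      · intro hy
        obtain ⟨N, hN⟩ := (hy.image fun n => n.natAbs).bddAbove
        refine ⟨N, fun n hn hw => ?_⟩
        have := hN (Set.mem_image_of_mem _ hw)
        rw [Int.abs_eq_natAbs] at hn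
        omega
      · rintro ⟨N, hN⟩
        refine (Set.finite_Icc (-(N : ℤ)) N).subset fun n hn => abs_le.1 ?_
        by_contra hlt
        exact hN n (not_le.1 hlt) hn
    simp only [Set.mem_inter_iff, Set.mem_iInter, Set.mem_iUnion, Set.mem_ofPred_eq,
      Set.mem_compl_iff]
    constructor
    · intro hw
      exact ⟨⟨⟨⟨hw.nearest, fun y => (hfin y).1 (hw.transient y)⟩, hw.pos⟩, hw.forward⟩, hw.backward⟩
    · rintro ⟨⟨⟨⟨h1, h2⟩, h3⟩, h4⟩, h5⟩
      exact ⟨h1, fun y => (hfin y).2 (h2 y), h3, h4, h5⟩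
  rw [h]
  refine ((((MeasurableSet.iInter fun n => ?_).inter (MeasurableSet.iInter fun y =>
    MeasurableSet.iUnion fun N => MeasurableSet.iInter fun n => MeasurableSet.iInter fun _ =>
      (measurableSet_eq_fun (by fun_prop) measurable_const).compl)).inter
    (MeasurableSet.iInter fun n => measurableSet_lt measurable_const (by fun_prop))).inter
    (measurableSet_eq_fun (by fun_prop) measurable_const)).inter
    (measurableSet_eq_fun (by fun_prop) measurable_const)
  have hm : Measurable fun w : ℤ → Site d × ℝ => (w (n + 1)).1 - (w n).1 := by fun_prop
  exact hm (MeasurableSet.of_discrete (s := {e : Site d | l1 e = 1}))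

/-- The total time spent at `y` by a doubly infinite path. -/
def totalTime {d : ℕ} (y : Site d) (w : ℤ → Site d × ℝ) : ℝ≥0∞ :=
  ∑' n : ℤ, if (w n).1 = y then ENNReal.ofReal (w n).2 else 0

lemma measurable_totalTime {d : ℕ} (y : Site d) : Measurable (totalTime y) := by
  refine Measurable.tsum fun n => ?_
  refine Measurable.ite ?_ (by fun_prop) measurable_const
  exact measurableSet_eq_fun (by fun_prop) measurable_const

lemma measurable_proj {d : ℕ} : Measurable (proj : Traj d → TrajMod d) := measurable_quotient_mk''

lemma measurable_timeAt {d : ℕ} (y : Site d) : Measurable (timeAt y) := by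
  rw [measurable_from_quotient]
  exact (measurable_totalTime y).comp measurable_subtype_coe

lemma totalTime_ne_top {d : ℕ} (y : Site d) {w : ℤ → Site d × ℝ} (hw : IsTrajectory w) :
    totalTime y w ≠ ∞ := by
  rw [totalTime, tsum_eq_sum (s := (hw.transient y).toFinset)]
  · refine (ENNReal.sum_lt_top.2 fun n _ => ?_).ne
    split_ifs
    · exact ENNReal.ofReal_lt_top
    · exact ENNReal.zero_lt_top
  · intro n hn
    rw [if_neg]
    simpa using hn

lemma timeAt_ne_top {d : ℕ} (y : Site d) (t : TrajMod d) : timeAt y t ≠ ∞ := by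
  induction t using Quotient.inductionOn with
  | h w => exact totalTime_ne_top y w.2

lemma proj_mem_entering {d : ℕ} {K : Finset (Site d)} {w : Traj d} :
    proj w ∈ entering K ↔ ∃ n, (w.1 n).1 ∈ K := by
  constructor
  · rintro ⟨w', ⟨n, hn⟩, h⟩
    obtain ⟨k, hk⟩ := Quotient.exact h
    refine ⟨n - -k, ?_⟩
    have := hk n
    rw [sub_neg_eq_add, ← this]
    exact hn
  · exact fun h => ⟨w, h, rfl⟩

lemma measurableSet_entering {d : ℕ} (K : Finset (Site d)) : MeasurableSet (entering K) := by
  change MeasurableSet (proj ⁻¹' entering K)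
  have : proj ⁻¹' entering K = ⋃ n : ℤ, ⋃ y ∈ K, {w : Traj d | (w.1 n).1 = y} := by
    ext w
    simp only [Set.mem_preimage, proj_mem_entering, Set.mem_iUnion, Set.mem_ofPred_eq]
    constructor
    · rintro ⟨n, hn⟩
      exact ⟨n, _, hn, rfl⟩
    · rintro ⟨n, y, hy, h⟩
      exact ⟨n, h ▸ hy⟩
  rw [this]
  refine MeasurableSet.iUnion fun n => Finset.measurableSet_biUnion _ fun y _ => ?_
  have h1 : Measurable fun w : ℤ → Site d × ℝ => (w n).1 := by fun_prop
  exact measurableSet_eq_fun (h1.comp measurable_subtype_coe) measurable_const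

lemma timeAt_eq_zero {d : ℕ} {K : Finset (Site d)} {y : Site d} (hy : y ∈ K) {t : TrajMod d}
    (ht : t ∉ entering K) : timeAt y t = 0 := by
  induction t using Quotient.inductionOn with
  | h w =>
    refine ENNReal.tsum_eq_zero.2 fun n => if_neg ?_
    rintro rfl
    exact ht (proj_mem_entering.2 ⟨n, hy⟩)

lemma measurable_glue {d : ℕ} :
    Measurable (glue : ((ℕ → Site d) × (ℕ → Site d)) × (ℤ → ℝ) → ℤ → Site d × ℝ) := by
  refine measurable_pi_lambda _ fun n => ?_
  refine Measurable.prodMk ?_ (by fun_prop)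
  by_cases hn : 0 ≤ n
  · simp only [hn, if_true]
    fun_prop
  · simp only [hn, if_false]
    fun_prop

lemma isTrajectory_glue {d : ℕ} {a b : ℕ → Site d} {σ : ℤ → ℝ} (hab : a 0 = b 0)
    (ha : ∀ n, l1 (a (n + 1) - a n) = 1) (hb : ∀ n, l1 (b (n + 1) - b n) = 1)
    (ha' : ∀ y, {n | a n = y}.Finite) (hb' : ∀ y, {n | b n = y}.Finite) (hσ : ∀ n, 0 < σ n)
    (hf : ∑' n : ℕ, ENNReal.ofReal (σ n) = ∞)
    (hr : ∑' n : ℕ, ENNReal.ofReal (σ (-(n : ℤ))) = ∞) : IsTrajectory (glue ((a, b), σ)) := by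
  -- At `k = 0` the value is read from the forward path, and `hab` reconciles the two. This covers
  -- the step from time `-1` to time `0`.
  have hneg : ∀ k : ℕ, (glue ((a, b), σ) (-(k : ℤ))).1 = b k := by
    intro k
    rcases Nat.eq_zero_or_pos k with rfl | hk
    · simpa [glue] using hab
    · have : ¬ (0 : ℤ) ≤ -(k : ℤ) := by omega
      simp only [glue, this, if_false, neg_neg, Int.toNat_natCast]
  have hnn : ∀ k : ℕ, (glue ((a, b), σ) k).1 = a k := by
    intro k
    simp [glue]
  refine ⟨fun n => ?_, fun y => ?_, hσ, hf, hr⟩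
  · rcases le_or_gt 0 n with hn | hn
    · obtain ⟨k, rfl⟩ := Int.eq_ofNat_of_zero_le hn
      have h1 := hnn (k + 1)
      push_cast at h1
      rw [h1, hnn]
      exact ha k
    · obtain ⟨k, rfl⟩ : ∃ k : ℕ, n = -((k : ℤ) + 1) := ⟨(-n - 1).toNat, by omega⟩
      have h1 := hneg (k + 1)
      push_cast at h1
      rw [h1, show -((k : ℤ) + 1) + 1 = -(k : ℤ) by ring, hneg, ← hb k]
      simp only [l1, Pi.sub_apply]
      exact Finset.sum_congr rfl fun i _ => abs_sub_comm _ _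
  · refine (((ha' y).image fun k : ℕ => (k : ℤ)).union
      ((hb' y).image fun k : ℕ => -(k : ℤ))).subset fun n hn => ?_
    rcases le_or_gt 0 n with h0 | h0
    · obtain ⟨k, rfl⟩ := Int.eq_ofNat_of_zero_le h0
      exact Or.inl ⟨k, (hnn k).symm.trans hn, rfl⟩
    · obtain ⟨k, rfl⟩ : ∃ k : ℕ, n = -(k : ℤ) := ⟨(-n).toNat, by omega⟩
      exact Or.inr ⟨k, (hneg k).symm.trans hn, rfl⟩

/-- Negative times read the backward path at indices at least `1`, where it avoids `K`, so only the
forward walk is seen in `K`. -/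
lemma totalTime_glue {d : ℕ} {K : Finset (Site d)} {a b : ℕ → Site d} {σ : ℤ → ℝ}
    (hb : b ∈ noReturn K) {y : Site d} (hy : y ∈ K) :
    totalTime y (glue ((a, b), σ)) = walkTime y (a, σ) := by
  rw [totalTime, walkTime]
  refine ((Nat.cast_injective (R := ℤ)).tsum_eq (f := fun n : ℤ =>
    if (glue ((a, b), σ) n).1 = y then ENNReal.ofReal (glue ((a, b), σ) n).2 else 0) ?_).symm.trans ?_
  · intro n hn
    by_contra h
    have hneg : ¬ 0 ≤ n := fun h0 => h ⟨n.toNat, by simp [h0]⟩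
    refine hn (if_neg fun h1 => hb (-n).toNat (by omega) ?_)
    simp only [glue, hneg, if_false] at h1
    rw [h1]
    exact hy
  · refine tsum_congr fun n => ?_
    simp [glue]

/-- The joint law of the forward path, the backward path and the holding times. -/
def tripleLaw {d : ℕ} (K : Finset (Site d)) (x : Site d) :
    Measure (((ℕ → Site d) × (ℕ → Site d)) × (ℤ → ℝ)) :=
  ((walkLaw x).prod ((walkLaw x)[|noReturn K])).prod holdLaw

lemma isProbabilityMeasure_cond_noReturn {d : ℕ} (hd : 0 < d) {K : Finset (Site d)} {x : Site d}
    (hx : x ∈ K) (hex : equilibrium K x ≠ 0) :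
    IsProbabilityMeasure ((walkLaw x)[|noReturn K]) := by
  have := isProbabilityMeasure_walkLaw hd x
  rw [equilibrium, if_pos hx] at hex
  exact cond_isProbabilityMeasure hex

/-- The backward path is integrated out. This requires positive equilibrium mass, as otherwise the
conditioned law is the zero measure. -/
lemma measurePreserving_tripleLaw {d : ℕ} (hd : 0 < d) {K : Finset (Site d)} {x : Site d}
    (hx : x ∈ K) (hex : equilibrium K x ≠ 0) :
    MeasurePreserving (fun p : ((ℕ → Site d) × (ℕ → Site d)) × (ℤ → ℝ) => (p.1.1, p.2))
      (tripleLaw K x) ((walkLaw x).prod holdLaw) := by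
  have := isProbabilityMeasure_walkLaw hd x
  have := isProbabilityMeasure_cond_noReturn hd hx hex
  exact (measurePreserving_fst (μ := walkLaw x) (ν := (walkLaw x)[|noReturn K])).prod
    (MeasurePreserving.id holdLaw)

lemma ae_tripleLaw {d : ℕ} (hd : 3 ≤ d) (K : Finset (Site d)) (x : Site d) :
    ∀ᵐ p ∂tripleLaw K x, IsTrajectory (glue p) ∧
      ∀ y ∈ K, totalTime y (glue p) = walkTime y (p.1.1, p.2) := by
  have hd0 : 0 < d := by omega
  have := isProbabilityMeasure_walkLaw hd0 x
  have hw : ∀ᵐ w ∂walkLaw x, w 0 = x ∧ (∀ n, l1 (w (n + 1) - w n) = 1) ∧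
      ∀ y, {n | w n = y}.Finite := by
    filter_upwards [walkLaw_start hd0 x, walkLaw_nearest hd0 x, walkLaw_transient hd x]
      with w h1 h2 h3 using ⟨h1, h2, h3⟩
  -- The conditioned law is absolutely continuous with respect to the walk and inherits its almost
  -- sure properties.
  have hb : ∀ᵐ w ∂(walkLaw x)[|noReturn K], w 0 = x ∧ (∀ n, l1 (w (n + 1) - w n) = 1) ∧
      ∀ y, {n | w n = y}.Finite := cond_absolutelyContinuous.ae_le hw
  have hb' : ∀ᵐ w ∂(walkLaw x)[|noReturn K], w ∈ noReturn K :=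
    ae_cond_mem (measurableSet_noReturn K)
  have h12 := Measure.quasiMeasurePreserving_fst
    (μ := (walkLaw x).prod ((walkLaw x)[|noReturn K])) (ν := holdLaw)
  have h1 := (Measure.quasiMeasurePreserving_fst.comp h12).ae hw
  have h2 := (Measure.quasiMeasurePreserving_snd.comp h12).ae (hb.and hb')
  have h3 := (Measure.quasiMeasurePreserving_snd
    (μ := (walkLaw x).prod ((walkLaw x)[|noReturn K])) (ν := holdLaw)).ae
    (holdLaw_pos.and (holdLaw_forward.and holdLaw_backward))
  filter_upwards [h1, h2, h3] with p hp1 hp2 hp3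
  obtain ⟨⟨a, b⟩, σ⟩ := p
  refine ⟨isTrajectory_glue (hp1.1.trans hp2.1.1.symm) hp1.2.1 hp2.1.2.1 hp1.2.2 hp2.1.2.2
    hp3.1 hp3.2.1 hp3.2.2, fun y hy => totalTime_glue hp2.2 hy⟩

/-- Pulling back to `Traj d` and pushing forward again restricts to the trajectories; nothing is
lost because glued paths are almost surely trajectories. -/
lemma map_entranceMeasure {d : ℕ} (hd : 3 ≤ d) (K : Finset (Site d)) :
    (entranceMeasure K).map Subtype.val =
      ∑ x ∈ K, equilibrium K x • (tripleLaw K x).map glue := by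
  have hS := measurableSet_isTrajectory d
  have hemb : MeasurableEmbedding (Subtype.val : Traj d → ℤ → Site d × ℝ) :=
    MeasurableEmbedding.subtype_coe hS
  have h1 : (entranceMeasure K).map Subtype.val =
      (∑ x ∈ K, equilibrium K x • (tripleLaw K x).map glue).restrict
        (Set.range (Subtype.val : Traj d → ℤ → Site d × ℝ)) := hemb.map_comap _
  rw [h1]
  refine Measure.restrict_eq_self_of_ae_mem ?_
  have hrange : Set.range (Subtype.val : Traj d → ℤ → Site d × ℝ) = {w | IsTrajectory w} :=
    Subtype.range_coe
  rw [hrange]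
  rw [ae_iff, Measure.finsetSum_apply]
  refine Finset.sum_eq_zero fun x _ => ?_
  rw [Measure.smul_apply, smul_eq_mul]
  refine mul_eq_zero_of_right _ ?_
  refine ae_iff.1 ((ae_map_iff measurable_glue.aemeasurable hS).2 ?_)
  filter_upwards [ae_tripleLaw hd K x] with p hp using hp.1

/-- The exponential of the potential accumulated by a trajectory modulo time-shift. -/
def expTimes {d : ℕ} (K : Finset (Site d)) (V : Site d → ℂ) (t : TrajMod d) : ℂ :=
  Complex.exp (∑ y ∈ K, V y * ((timeAt y t).toReal : ℂ))

lemma measurable_expTimes {d : ℕ} (K : Finset (Site d)) (V : Site d → ℂ) :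
    Measurable (expTimes K V) := by
  refine Complex.measurable_exp.comp (Finset.measurable_fun_sum _ fun y _ => ?_)
  exact (Complex.measurable_ofReal.comp (measurable_timeAt y).ennreal_toReal).const_mul _

lemma intensity_entering_lt_top {d : ℕ} (hd : 3 ≤ d) {ν : Measure (TrajMod d)}
    (hν : IsIntensity ν) (K : Finset (Site d)) : ν (entering K) < ∞ := by
  have hd0 : 0 < d := by omega
  rw [← Measure.restrict_apply_univ, hν.restrict_eq K,
    Measure.map_apply measurable_proj MeasurableSet.univ, Set.preimage_univ]
  have h1 : entranceMeasure K Set.univ = (entranceMeasure K).map Subtype.val Set.univ := by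
    rw [Measure.map_apply measurable_subtype_coe MeasurableSet.univ, Set.preimage_univ]
  rw [h1, map_entranceMeasure hd, Measure.finsetSum_apply]
  refine ENNReal.sum_lt_top.2 fun x hx => ?_
  rw [Measure.smul_apply, smul_eq_mul]
  by_cases hex : equilibrium K x = 0
  · simp [hex]
  · have := isProbabilityMeasure_walkLaw hd0 x
    have := isProbabilityMeasure_cond_noReturn hd0 hx hex
    refine ENNReal.mul_lt_top ((equilibrium_le_one hd0 K x).trans_lt ENNReal.one_lt_top) ?_
    rw [Measure.map_apply measurable_glue MeasurableSet.univ, Set.preimage_univ, tripleLaw]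
    exact measure_lt_top _ _

/-- Change of variables from `ν` through `Q_K` to the walk with holding times. Sites of zero
equilibrium mass are treated apart, since there the conditioned law degenerates. -/
lemma integral_expTimes {d : ℕ} (hd : 3 ≤ d) {ν : Measure (TrajMod d)} (hν : IsIntensity ν)
    {K : Finset (Site d)} {c : ℝ} (hc : IsSmall K c) {V : Site d → ℂ} (hV : ∀ x, ‖V x‖ ≤ c)
    (hK : ∀ x, x ∉ K → V x = 0) :
    Integrable (expTimes K V) (ν.restrict (entering K)) ∧
      ∫ t in entering K, (expTimes K V t - 1) ∂ν = ∑ x ∈ K, ((equilibrium K x).toReal : ℂ) *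
        (∫ p, expTotal K V p ∂((walkLaw x).prod holdLaw) - 1) := by
  have hd0 : 0 < d := by omega
  set f : (ℤ → Site d × ℝ) → ℂ :=
    fun w => Complex.exp (∑ y ∈ K, V y * ((totalTime y w).toReal : ℂ)) - 1 with hf
  have hfm : Measurable f := by
    refine Measurable.sub_const (Complex.measurable_exp.comp
      (Finset.measurable_fun_sum _ fun y _ => ?_)) 1
    exact (Complex.measurable_ofReal.comp (measurable_totalTime y).ennreal_toReal).const_mul _
  have hgm : Measurable fun t => expTimes K V t - 1 := (measurable_expTimes K V).sub_const 1
  have hcongr : ∀ x, ∀ᵐ p ∂tripleLaw K x, f (glue p) = expTotal K V (p.1.1, p.2) - 1 := by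
    intro x
    filter_upwards [ae_tripleLaw hd K x] with p hp
    simp only [hf, expTotal]
    congr 2
    exact Finset.sum_congr rfl fun y hy => by rw [hp.2 y hy]
  have hterm : ∀ x ∈ K, Integrable f (equilibrium K x • (tripleLaw K x).map glue) ∧
      ∫ w, f w ∂(equilibrium K x • (tripleLaw K x).map glue) = ((equilibrium K x).toReal : ℂ) *
        (∫ p, expTotal K V p ∂((walkLaw x).prod holdLaw) - 1) := by
    intro x hx
    by_cases hex : equilibrium K x = 0
    · simp [hex]
    have := isProbabilityMeasure_walkLaw hd0 x
    have hmp := measurePreserving_tripleLaw hd0 hx hex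
    have hi := integrable_expTotal hd hc hV hK x
    have hi' : Integrable (fun p => expTotal K V p - 1) ((walkLaw x).prod holdLaw) :=
      hi.sub (integrable_const 1)
    constructor
    · refine Integrable.smul_measure ?_
        ((equilibrium_le_one hd0 K x).trans_lt ENNReal.one_lt_top).ne
      rw [integrable_map_measure hfm.aestronglyMeasurable measurable_glue.aemeasurable]
      refine (integrable_congr (hcongr x)).2 ?_
      exact (hmp.integrable_comp hi'.1).2 hi'
    · rw [integral_smul_measure, integral_map measurable_glue.aemeasurable hfm.aestronglyMeasurable,
        integral_congr_ae (hcongr x), Complex.real_smul]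
      congr 1
      have h1 : ∫ p, (expTotal K V (p.1.1, p.2) - 1) ∂tripleLaw K x =
          ∫ q, (expTotal K V q - 1) ∂((walkLaw x).prod holdLaw) := by
        rw [← hmp.map_eq, integral_map hmp.measurable.aemeasurable]
        rw [hmp.map_eq]
        exact hi'.1
      rw [h1, integral_sub hi (integrable_const 1)]
      simp
  have hE : ∀ w : Traj d, expTimes K V (proj w) - 1 = f w.1 := fun w => rfl
  constructor
  · have h1 : Integrable (fun t => expTimes K V t - 1) (ν.restrict (entering K)) := by
      rw [hν.restrict_eq K, integrable_map_measure hgm.aestronglyMeasurable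
        measurable_proj.aemeasurable]
      have h2 : Integrable f ((entranceMeasure K).map Subtype.val) := by
        rw [map_entranceMeasure hd, integrable_finsetSum_measure]
        exact fun x hx => (hterm x hx).1
      exact (integrable_map_measure hfm.aestronglyMeasurable
        measurable_subtype_coe.aemeasurable).1 h2
    have : IsFiniteMeasure (ν.restrict (entering K)) :=
      isFiniteMeasure_restrict.2 (intensity_entering_lt_top hd hν K).ne
    refine (integrable_congr (ae_of_all _ fun t => ?_)).1 (h1.add (integrable_const (1 : ℂ)))
    simp
  · rw [hν.restrict_eq K, integral_map measurable_proj.aemeasurable hgm.aestronglyMeasurable]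
    simp only [hE]
    rw [← integral_map (μ := entranceMeasure K) measurable_subtype_coe.aemeasurable
      hfm.aestronglyMeasurable, map_entranceMeasure hd,
      integral_finsetSum_measure fun x hx => (hterm x hx).1]
    exact Finset.sum_congr rfl fun x hx => (hterm x hx).2

/-- The exponential moment of the intensity measure, through the Feynman–Kac equation. -/
theorem exists_feynman_kac_integral {d : ℕ} (hd : 3 ≤ d) {K : Finset (Site d)} {c : ℝ}
    (hc : IsSmall K c) {V : Site d → ℂ} (hV : ∀ x, ‖V x‖ ≤ c) (hK : ∀ x, x ∉ K → V x = 0) :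
    ∃ φ : Site d → ℂ, (∀ x, ‖φ x‖ ≤ 2) ∧
      (∀ x, φ x = 1 + ∑ y ∈ K, ((green x y).toReal : ℂ) * (V y * φ y)) ∧
      ∀ ν : Measure (TrajMod d), IsIntensity ν →
        ∫ t in entering K, (expTimes K V t - 1) ∂ν = ∑ y ∈ K, V y * φ y := by
  set φ : Site d → ℂ := fun x => ∫ p, expTotal K V p ∂((walkLaw x).prod holdLaw) with hφ
  have hlim := tendsto_fk hd hc hV hK
  have hfk := feynman_kac hd hc hV hK hlim
  refine ⟨φ, fun x => ?_, hfk, fun ν hν => ?_⟩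
  · exact le_of_tendsto' (hlim x).norm fun n => norm_fk_le_two hd hc hV hK n x
  · rw [(integral_expTimes hd hν hc hV hK).2]
    have h1 : ∀ x, (∫ p, expTotal K V p ∂((walkLaw x).prod holdLaw)) - 1 =
        ∑ y ∈ K, ((green x y).toReal : ℂ) * (V y * φ y) := by
      intro x
      rw [hfk x, add_sub_cancel_left]
    simp only [h1, Finset.mul_sum]
    rw [Finset.sum_comm]
    refine Finset.sum_congr rfl fun y hy => ?_
    -- After exchanging the sums, the equilibrium measure meets the Green function and the inner sum
    -- is `1`.
    have h2 := sum_toReal_equilibrium_mul_green hd hy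
    have h3 : ∑ x ∈ K, ((equilibrium K x).toReal : ℂ) * ((green x y).toReal : ℂ) = 1 := by
      exact_mod_cast h2
    simp only [← mul_assoc]
    rw [← Finset.sum_mul, ← Finset.sum_mul, h3, one_mul]

/-! ### The operator `G V` -/

lemma greenOp_eq_sum {d : ℕ} {K : Finset (Site d)} {V : Site d → ℂ} (hK : ∀ x, x ∉ K → V x = 0)
    (f : Site d → ℂ) (x : Site d) :
    greenOp (fun y => V y * f y) x = ∑ y ∈ K, ((green x y).toReal : ℂ) * (V y * f y) :=
  tsum_eq_sum fun y hy => by simp [hK y hy]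

lemma pairing_eq_sum {d : ℕ} {K : Finset (Site d)} {V : Site d → ℂ} (hK : ∀ x, x ∉ K → V x = 0)
    (f : Site d → ℂ) : pairing V f = ∑ y ∈ K, V y * f y :=
  tsum_eq_sum fun y hy => by simp [hK y hy]

lemma greenOp_mul_add {d : ℕ} {K : Finset (Site d)} {V : Site d → ℂ} (hK : ∀ x, x ∉ K → V x = 0)
    (f g : Site d → ℂ) (x : Site d) : greenOp (fun y => V y * (f y + g y)) x =
      greenOp (fun y => V y * f y) x + greenOp (fun y => V y * g y) x := by
  rw [greenOp_eq_sum hK, greenOp_eq_sum hK, greenOp_eq_sum hK, ← Finset.sum_add_distrib]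
  exact Finset.sum_congr rfl fun y _ => by ring

lemma greenOp_mul_smul {d : ℕ} {K : Finset (Site d)} {V : Site d → ℂ} (hK : ∀ x, x ∉ K → V x = 0)
    (a : ℂ) (f : Site d → ℂ) (x : Site d) :
    greenOp (fun y => V y * (a * f y)) x = a * greenOp (fun y => V y * f y) x := by
  rw [greenOp_eq_sum hK, greenOp_eq_sum hK, Finset.mul_sum]
  exact Finset.sum_congr rfl fun y _ => by ring

lemma norm_greenOp_le {d : ℕ} {K : Finset (Site d)} {c : ℝ} (hc : IsSmall K c) {V : Site d → ℂ}
    (hV : ∀ x, ‖V x‖ ≤ c) (hK : ∀ x, x ∉ K → V x = 0) (f : Linf d) (x : Site d) :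
    ‖greenOp (fun y => V y * f y) x‖ ≤ 1 / 2 * ‖f‖ := by
  rw [greenOp_eq_sum hK]
  calc _ ≤ ∑ y ∈ K, (green x y).toReal * c * ‖f‖ := by
        refine (norm_sum_le _ _).trans (Finset.sum_le_sum fun y _ => ?_)
        rw [norm_mul, norm_mul, Complex.norm_real, Real.norm_of_nonneg ENNReal.toReal_nonneg,
          mul_assoc]
        exact mul_le_mul_of_nonneg_left
          (mul_le_mul (hV y) (lp.norm_apply_le_norm ENNReal.top_ne_zero f y) (norm_nonneg _) hc.pos.le)
          ENNReal.toReal_nonneg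
    _ = (∑ y ∈ K, (green x y).toReal * c) * ‖f‖ := by rw [Finset.sum_mul]
    _ ≤ 1 / 2 * ‖f‖ := mul_le_mul_of_nonneg_right (hc.green_le x) (norm_nonneg _)

/-- A small potential defines a contraction `G V` of `L^∞`. -/
theorem exists_greenPotential {d : ℕ} {K : Finset (Site d)} {c : ℝ} (hc : IsSmall K c)
    {V : Site d → ℂ} (hV : ∀ x, ‖V x‖ ≤ c) (hK : ∀ x, x ∉ K → V x = 0) :
    ∃ GV : Linf d →L[ℂ] Linf d, (∀ f x, GV f x = greenOp (fun y => V y * f y) x) ∧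
      ‖GV‖ ≤ 1 / 2 := by
  have hmem : ∀ f : Linf d, Memℓp (fun x => greenOp (fun y => V y * f y) x) ∞ := by
    intro f
    refine memℓp_infty ⟨1 / 2 * ‖f‖, ?_⟩
    rintro _ ⟨x, rfl⟩
    exact norm_greenOp_le hc hV hK f x
  let A : Linf d →ₗ[ℂ] Linf d :=
    { toFun := fun f => ⟨fun x => greenOp (fun y => V y * f y) x, hmem f⟩
      map_add' := fun f g => by
        refine lp.ext (funext fun x => ?_)
        change greenOp (fun y => V y * (f y + g y)) x =
          greenOp (fun y => V y * f y) x + greenOp (fun y => V y * g y) x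
        exact greenOp_mul_add hK f g x
      map_smul' := fun a f => by
        refine lp.ext (funext fun x => ?_)
        change greenOp (fun y => V y * (a * f y)) x = a * greenOp (fun y => V y * f y) x
        exact greenOp_mul_smul hK a f x }
  have hA : ∀ f, ‖A f‖ ≤ 1 / 2 * ‖f‖ := fun f =>
    lp.norm_le_of_forall_le (by positivity) fun x => norm_greenOp_le hc hV hK f x
  exact ⟨A.mkContinuous (1 / 2) hA, fun f x => rfl, A.mkContinuous_norm_le (by norm_num) hA⟩

/-- A bounded solution of the Feynman–Kac equation is an element of `Linf d` sent to `1` by `1 -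
GV`, which is invertible by the Neumann series. -/
lemma inverse_one_sub_apply_one {d : ℕ} {K : Finset (Site d)} {V : Site d → ℂ}
    (hK : ∀ x, x ∉ K → V x = 0) {GV : Linf d →L[ℂ] Linf d}
    (hGV : ∀ f x, GV f x = greenOp (fun y => V y * f y) x) (hlt : ‖GV‖ < 1) {φ : Site d → ℂ}
    {B : ℝ} (hB : ∀ x, ‖φ x‖ ≤ B)
    (hφ : ∀ x, φ x = 1 + ∑ y ∈ K, ((green x y).toReal : ℂ) * (V y * φ y)) (x : Site d) :
    (Ring.inverse (1 - GV) 1 : Linf d) x = φ x := by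
  have hmem : Memℓp φ ∞ := by
    refine memℓp_infty ⟨B, ?_⟩
    rintro _ ⟨x, rfl⟩
    exact hB x
  set Φ : Linf d := ⟨φ, hmem⟩ with hΦ
  have h1 : (1 - GV) Φ = 1 := by
    refine lp.ext (funext fun x => ?_)
    have h2 : GV Φ x = greenOp (fun y => V y * φ y) x := hGV Φ x
    change φ x - GV Φ x = (1 : Linf d) x
    rw [h2, greenOp_eq_sum hK, lp.infty_coeFn_one, Pi.one_apply, hφ x]
    rw [add_sub_assoc, sub_eq_zero.2 rfl, add_zero]
  have h3 : Ring.inverse (1 - GV) 1 = Φ := by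
    rw [← h1, ← mul_apply_eq_comp,
      Ring.inverse_mul_cancel _ (isUnit_one_sub_of_norm_lt_one hlt)]
    rfl
  rw [h3]

/-! ### The occupation times -/

/-- The time spent at `y` by a labelled trajectory with label at most `u`. -/
def labelledTime {d : ℕ} (u : ℝ) (y : Site d) (p : TrajMod d × ℝ) : ℝ≥0∞ :=
  if p.2 ≤ u then timeAt y p.1 else 0

lemma measurable_labelledTime {d : ℕ} (u : ℝ) (y : Site d) : Measurable (labelledTime u y) :=
  Measurable.ite (measurableSet_le measurable_snd measurable_const)
    ((measurable_timeAt y).comp measurable_fst) measurable_const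

lemma lintegral_labelledTime {d : ℕ} (u : ℝ) (y : Site d) (p : ℕ → TrajMod d × ℝ) :
    ∫⁻ e, labelledTime u y e ∂(Measure.sum fun i => Measure.dirac (p i)) = occTime p y u := by
  rw [lintegral_sum_measure]
  exact tsum_congr fun i => lintegral_dirac' _ (measurable_labelledTime u y)

lemma restrict_Ici_Iic (u : ℝ) :
    (volume.restrict (Set.Ici (0 : ℝ))) (Set.Iic u) = ENNReal.ofReal u := by
  rw [Measure.restrict_apply measurableSet_Iic, Set.inter_comm, Set.Ici_inter_Iic,
    Real.volume_Icc, sub_zero]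

/-- The Laplace functional of the occupation times, in terms of the intensity measure. -/
lemma occTime_exponential_formula {d : ℕ} (hd : 3 ≤ d) {Ω : Type*} [MeasurableSpace Ω]
    {P : Measure Ω} [IsProbabilityMeasure P] {pts : Ω → ℕ → TrajMod d × ℝ}
    {ν : Measure (TrajMod d)} (hν : IsIntensity ν)
    (hpts : IsPoisson P (fun ω => Measure.sum fun i => Measure.dirac (pts ω i))
      (ν.prod (volume.restrict (Set.Ici (0 : ℝ)))))
    {K : Finset (Site d)} {c : ℝ} (hc : IsSmall K c) {u : ℝ} (hu : 0 ≤ u) :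
    (∀ᵐ ω ∂P, ∀ y ∈ K, occTime (pts ω) y u ≠ ∞) ∧
      ∀ V : Site d → ℂ, (∀ x, ‖V x‖ ≤ c) →
        Integrable (fun ω => Complex.exp
          (∑ y ∈ K, V y * ((occTime (pts ω) y u).toReal : ℂ))) P ∧
        ∫ ω, Complex.exp (∑ y ∈ K, V y * ((occTime (pts ω) y u).toReal : ℂ)) ∂P =
          Complex.exp (u * ∫ t in entering K, (expTimes K V t - 1) ∂ν) := by
  have := hν.sigmaFinite
  -- A set of finite intensity outside which the labelled times at sites of `K` vanish.
  set A : Set (TrajMod d × ℝ) := entering K ×ˢ Set.Iic u with hA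
  have hAm : MeasurableSet A := (measurableSet_entering K).prod measurableSet_Iic
  have hνK := intensity_entering_lt_top hd hν K
  have hmA : (ν.prod (volume.restrict (Set.Ici (0 : ℝ)))) A ≠ ∞ := by
    rw [hA, Measure.prod_prod, restrict_Ici_Iic]
    exact ENNReal.mul_ne_top hνK.ne ENNReal.ofReal_ne_top
  have hsum : ∀ (V : Site d → ℂ) (f : Site d → ℂ),
      ∑ y ∈ K, V y * f y = ∑ y : K, V y * f y := fun V f =>
    (Finset.sum_coe_sort K fun y => V y * f y).symm
  have hlab : ∀ y : Site d, ∀ e : TrajMod d × ℝ, labelledTime u y e ≠ ∞ := by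
    intro y e
    rw [labelledTime]
    split_ifs
    · exact timeAt_ne_top y e.1
    · exact ENNReal.zero_ne_top
  have hzero : ∀ y ∈ K, ∀ e : TrajMod d × ℝ, e ∉ A → labelledTime u y e = 0 := by
    intro y hy e he
    rw [labelledTime]
    split_ifs with h
    · exact timeAt_eq_zero hy fun h' => he ⟨h', h⟩
    · rfl
  have hint : Integrable (fun e => Real.exp (c * ∑ y : K, (labelledTime u (y : Site d) e).toReal))
      ((ν.prod (volume.restrict (Set.Ici (0 : ℝ)))).restrict A) := by
    have h1 := (integral_expTimes hd hν hc (norm_constOn_le hc.pos.le) constOn_of_notMem).1.norm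
    have hfin : IsFiniteMeasure ((volume.restrict (Set.Ici (0 : ℝ))).restrict (Set.Iic u)) :=
      isFiniteMeasure_restrict.2 (by rw [restrict_Ici_Iic]; exact ENNReal.ofReal_ne_top)
    have h2 := h1.comp_fst ((volume.restrict (Set.Ici (0 : ℝ))).restrict (Set.Iic u))
    rw [Measure.prod_restrict] at h2
    refine h2.congr ?_
    filter_upwards [ae_restrict_mem hAm] with e he
    have h3 : ∑ y ∈ K, constOn K c y * ((timeAt y e.1).toReal : ℂ) =
        ((c * ∑ y : K, (labelledTime u (y : Site d) e).toReal : ℝ) : ℂ) := by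
      have h4 : ∑ y : K, (labelledTime u (y : Site d) e).toReal =
          ∑ y ∈ K, (timeAt y e.1).toReal := by
        rw [← Finset.sum_coe_sort K]
        exact Finset.sum_congr rfl fun y _ => by
          rw [labelledTime, if_pos (Set.mem_Iic.1 he.2)]
      rw [h4, Finset.mul_sum, Complex.ofReal_sum]
      refine Finset.sum_congr rfl fun y hy => ?_
      rw [constOn, if_pos hy, Complex.ofReal_mul]
    rw [expTimes, h3, Complex.norm_exp, Complex.ofReal_re]
  obtain ⟨hfin, hform⟩ := hpts.exponential_formula (F := fun (y : K) e => labelledTime u y.1 e)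
    (fun y => measurable_labelledTime u y.1) (fun y e => hlab y e) hAm hmA
    (fun y e he => hzero y y.2 e he) hc.pos hint
  simp only [lintegral_labelledTime] at hfin hform
  refine ⟨?_, fun V hV => ?_⟩
  · filter_upwards [hfin] with ω hω y hy using hω ⟨y, hy⟩
  obtain ⟨h1, h2⟩ := hform (fun y => V y) fun y => hV y
  simp only [hsum V]
  refine ⟨h1, h2.trans ?_⟩
  congr 1
  -- The integrand is a product of a function of the trajectory and one of the label; the label
  -- integrates to `u`.
  have h3 : ∀ e : TrajMod d × ℝ,
      Complex.exp (∑ y : K, V y * ((labelledTime u (y : Site d) e).toReal : ℂ)) - 1 =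
        (entering K).indicator (fun t => expTimes K V t - 1) e.1 *
          (Set.Iic u).indicator (fun _ => (1 : ℂ)) e.2 := by
    intro e
    by_cases he : e ∈ A
    · rw [Set.indicator_of_mem he.1, Set.indicator_of_mem he.2, mul_one, expTimes, hsum]
      congr 2
      exact Finset.sum_congr rfl fun y _ => by
          rw [labelledTime, if_pos (Set.mem_Iic.1 he.2)]
    · have h4 : ∑ y : K, V y * ((labelledTime u (y : Site d) e).toReal : ℂ) = 0 :=
        Finset.sum_eq_zero fun y _ => by simp [hzero y y.2 e he]
      rw [h4, Complex.exp_zero, sub_self]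
      by_cases h5 : e.1 ∈ entering K
      · rw [Set.indicator_of_notMem (s := Set.Iic u) fun h6 => he ⟨h5, h6⟩, mul_zero]
      · rw [Set.indicator_of_notMem h5, zero_mul]
  simp only [h3]
  rw [integral_prod_mul (μ := ν) (ν := volume.restrict (Set.Ici (0 : ℝ)))
    ((entering K).indicator fun t => expTimes K V t - 1) ((Set.Iic u).indicator fun _ => (1 : ℂ)),
    integral_indicator (measurableSet_entering K), integral_indicator_const _ measurableSet_Iic,
    measureReal_def, restrict_Ici_Iic, ENNReal.toReal_ofReal hu, Complex.real_smul, mul_one,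
    mul_comm]

/-- The formula is applied to each singleton with its own small constant; the lattice being
countable, finiteness holds at all sites simultaneously. -/
lemma ae_occTime_lt_top {d : ℕ} (hd : 3 ≤ d) {Ω : Type*} [MeasurableSpace Ω] {P : Measure Ω}
    [IsProbabilityMeasure P] {pts : Ω → ℕ → TrajMod d × ℝ} (hpts : IsInterlacement P pts) {u : ℝ}
    (hu : 0 ≤ u) : ∀ᵐ ω ∂P, ∀ x, occTime (pts ω) x u < ∞ := by
  obtain ⟨ν, hν, hN⟩ := hpts
  rw [ae_all_iff]
  intro x
  obtain ⟨c, hc⟩ := exists_isSmall hd {x}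
  filter_upwards [(occTime_exponential_formula hd hν hN hc hu).1] with ω hω
  exact (hω x (Finset.mem_singleton_self x)).lt_top

/-- The Laplace functional of the occupation times of random interlacements. -/
theorem laplace_occTime {d : ℕ} (hd : 3 ≤ d) {K : Finset (Site d)} {c : ℝ} (hc : IsSmall K c)
    {V : Site d → ℂ} (hV : ∀ x, ‖V x‖ ≤ c) (hK : ∀ x, x ∉ K → V x = 0)
    {GV : Linf d →L[ℂ] Linf d} (hGV : ∀ f x, GV f x = greenOp (fun y => V y * f y) x)
    (hlt : ‖GV‖ < 1) {Ω : Type*} [MeasurableSpace Ω] {P : Measure Ω} [IsProbabilityMeasure P]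
    {pts : Ω → ℕ → TrajMod d × ℝ} (hpts : IsInterlacement P pts) {u : ℝ} (hu : 0 ≤ u) :
    Integrable (fun ω => Complex.exp
        (∑ x ∈ K, V x * ((occTime (pts ω) x u).toReal : ℂ))) P ∧
      ∫ ω, Complex.exp (∑ x ∈ K, V x * ((occTime (pts ω) x u).toReal : ℂ)) ∂P =
        Complex.exp (u * pairing V (Ring.inverse (1 - GV) 1 : Linf d)) := by
  obtain ⟨ν, hν, hN⟩ := hpts
  obtain ⟨φ, hφ2, hφ, hint⟩ := exists_feynman_kac_integral hd hc hV hK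
  obtain ⟨h1, h2⟩ := (occTime_exponential_formula hd hν hN hc hu).2 V hV
  refine ⟨h1, h2.trans ?_⟩
  rw [hint ν hν, pairing_eq_sum hK]
  simp only [inverse_one_sub_apply_one hK hGV hlt hφ2 hφ]

/-! ### Analyticity and conclusion -/

/-- The resolvent is analytic at the origin. -/
lemma analyticAt_resolvent {E : Type*} [NormedAddCommGroup E] [NormedSpace ℂ E] [CompleteSpace E]
    (A : E →L[ℂ] E) (v : E) : AnalyticAt ℂ (fun z : ℂ => Ring.inverse (1 - z • A) v) 0 := by
  have h1 : AnalyticAt ℂ (fun z : ℂ => Ring.inverse (1 - z • A)) 0 := by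
    have h2 : AnalyticAt ℂ (fun z : ℂ => z • A) 0 := analyticAt_id.smul analyticAt_const
    refine AnalyticAt.fun_comp (g := fun B : E →L[ℂ] E => Ring.inverse (1 - B)) ?_ h2
    rw [zero_smul]
    exact analyticAt_inverse_one_sub ℂ (E →L[ℂ] E)
  exact ((ContinuousLinearMap.apply ℂ E v).analyticAt _).fun_comp h1

/-- For a small potential `V`, the Laplace functional along the complex line through `V` is the
exponential of an analytic function. -/
theorem exists_analyticAt_laplace {d : ℕ} {K : Finset (Site d)} {c : ℝ}
    (hc : IsSmall K c) {V : Site d → ℂ} (hV : ∀ x, ‖V x‖ ≤ c) (hK : ∀ x, x ∉ K → V x = 0) :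
    ∃ F : ℂ → ℂ, AnalyticAt ℂ F 0 ∧ ∀ z : ℂ, ‖z‖ ≤ 1 → ∃ GV : Linf d →L[ℂ] Linf d,
      (∀ f x, GV f x = greenOp (fun y => z * V y * f y) x) ∧ ‖GV‖ < 1 ∧
      F z = pairing (fun y => z * V y) (Ring.inverse (1 - GV) 1 : Linf d) := by
  obtain ⟨A, hA, hA2⟩ := exists_greenPotential hc hV hK
  refine ⟨fun z => ∑ y ∈ K, z * V y * (Ring.inverse (1 - z • A) 1 : Linf d) y, ?_,
    fun z hz => ⟨z • A, fun f x => ?_, ?_, ?_⟩⟩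
  · refine Finset.analyticAt_fun_sum _ fun y _ => (analyticAt_id.mul analyticAt_const).mul ?_
    exact ((lp.evalCLM ℂ (fun _ : Site d => ℂ) ∞ y).analyticAt _).fun_comp
      (analyticAt_resolvent A 1)
  · change z * A f x = _
    rw [hA, ← greenOp_mul_smul hK]
    congr 1
    funext y
    ring
  · rw [norm_smul]
    calc ‖z‖ * ‖A‖ ≤ 1 * (1 / 2) := mul_le_mul hz hA2 (norm_nonneg _) zero_le_one
      _ < 1 := by norm_num
  · exact (pairing_eq_sum (fun x hx => by rw [hK x hx, mul_zero]) _).symm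

end Interlacement

end

theorem theorem2p1 (d : ℕ) (hd : 3 ≤ d) (K : Finset (Interlacement.Site d)) :
    (∃ c : ℝ, 0 < c ∧ ∀ V : Interlacement.Site d → ℂ,
      (∀ x, x ∉ K → V x = 0) → (∀ x, ‖V x‖ ≤ c) →
      ∃ GV : Interlacement.Linf d →L[ℂ] Interlacement.Linf d,
        (∀ f x, GV f x = Interlacement.greenOp (fun y => V y * f y) x) ∧
        ‖GV‖ < 1 ∧
        ∀ (Ω : Type*) [MeasurableSpace Ω] (P : Measure Ω) [IsProbabilityMeasure P]
          (pts : Ω → ℕ → Interlacement.TrajMod d × ℝ), Interlacement.IsInterlacement P pts →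
          ∀ u : ℝ, 0 ≤ u →
            (∀ᵐ ω ∂P, ∀ x, Interlacement.occTime (pts ω) x u < ∞) ∧
            Integrable
              (fun ω => Complex.exp
                (∑ x ∈ K, V x * ((Interlacement.occTime (pts ω) x u).toReal : ℂ))) P ∧
            ∫ ω, Complex.exp
                (∑ x ∈ K, V x * ((Interlacement.occTime (pts ω) x u).toReal : ℂ)) ∂P =
              Complex.exp (u * Interlacement.pairing V (Ring.inverse (1 - GV) 1))) ∧
    (∀ V : Interlacement.Site d → ℝ, (∀ x, x ∉ K → V x = 0) →
      ∃ F : ℂ → ℂ, AnalyticAt ℂ F 0 ∧ ∃ r : ℝ, 0 < r ∧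
        ∀ (Ω : Type*) [MeasurableSpace Ω] (P : Measure Ω) [IsProbabilityMeasure P]
          (pts : Ω → ℕ → Interlacement.TrajMod d × ℝ), Interlacement.IsInterlacement P pts →
          ∀ u : ℝ, 0 ≤ u → ∀ t : ℝ, |t| < r →
            ∫ ω, Complex.exp (Complex.I * t *
                ((∑ x ∈ K, V x * (Interlacement.occTime (pts ω) x u).toReal : ℝ) : ℂ)) ∂P =
              Complex.exp (u * F t)) := by
  obtain ⟨c, hc⟩ := Interlacement.exists_isSmall hd K
  refine ⟨⟨c, hc.pos, fun V hK hV => ?_⟩, fun V hK => ?_⟩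
  · obtain ⟨GV, hGV, hle⟩ := Interlacement.exists_greenPotential hc hV hK
    have hlt : ‖GV‖ < 1 := hle.trans_lt (by norm_num)
    refine ⟨GV, hGV, hlt, fun Ω _ P _ pts hpts u hu => ⟨?_, ?_⟩⟩
    · exact Interlacement.ae_occTime_lt_top hd hpts hu
    · exact Interlacement.laplace_occTime hd hc hV hK hGV hlt hpts hu
  -- A bound for `V` that stays positive when `V = 0`.
  · set M : ℝ := 1 + ∑ x ∈ K, |V x| with hM
    have hM0 : 0 < M := by
      have : 0 ≤ ∑ x ∈ K, |V x| := Finset.sum_nonneg fun _ _ => abs_nonneg _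
      linarith
    have hVM : ∀ x, |V x| ≤ M := by
      intro x
      by_cases hx : x ∈ K
      · have : |V x| ≤ ∑ x ∈ K, |V x| :=
          Finset.single_le_sum (f := fun x => |V x|) (fun _ _ => abs_nonneg _) hx
        linarith
      · rw [hK x hx, abs_zero]
        exact hM0.le
    have hcM : 0 < c / M := div_pos hc.pos hM0
    -- Scaled so that `‖W x‖ ≤ c` and `i t V = z W` with `z = t / (c / M)`. Thus `|t| < c / M`
    -- ensures `‖z‖ ≤ 1`, and the radius is `r = c / M`.
    set W : Interlacement.Site d → ℂ := fun x => Complex.I * ((c / M * V x : ℝ) : ℂ) with hW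
    have hWc : ∀ x, ‖W x‖ ≤ c := by
      intro x
      rw [hW, norm_mul, Complex.norm_I, one_mul, Complex.norm_real, Real.norm_eq_abs, abs_mul,
        abs_of_pos hcM, div_mul_eq_mul_div, div_le_iff₀ hM0]
      exact mul_le_mul_of_nonneg_left (hVM x) hc.pos.le
    have hWK : ∀ x, x ∉ K → W x = 0 := fun x hx => by simp [hW, hK x hx]
    obtain ⟨F, hF, hFz⟩ := Interlacement.exists_analyticAt_laplace hc hWc hWK
    refine ⟨fun z => F (z * ((c / M : ℝ) : ℂ)⁻¹), ?_, c / M, hcM, ?_⟩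
    · refine AnalyticAt.fun_comp (g := F) ?_ (analyticAt_id.mul analyticAt_const)
      simpa using hF
    intro Ω _ P _ pts hpts u hu t ht
    have hz : ‖(t : ℂ) * ((c / M : ℝ) : ℂ)⁻¹‖ ≤ 1 := by
      rw [norm_mul, norm_inv, Complex.norm_real, Complex.norm_real, Real.norm_eq_abs,
        Real.norm_of_nonneg hcM.le, ← div_eq_mul_inv, div_le_one hcM]
      exact ht.le
    obtain ⟨GV, hGV, hlt, hFt⟩ := hFz _ hz
    have h := (Interlacement.laplace_occTime hd hc
      (V := fun x => (t : ℂ) * ((c / M : ℝ) : ℂ)⁻¹ * W x)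
      (fun x => by
        rw [norm_mul]
        exact (mul_le_mul hz (hWc x) (norm_nonneg _) zero_le_one).trans_eq (one_mul c))
      (fun x hx => by rw [hWK x hx, mul_zero]) hGV hlt hpts hu).2
    rw [← hFt] at h
    rw [← h]
    congr 1
    funext ω
    congr 1
    have hne : ((c / M : ℝ) : ℂ) ≠ 0 := Complex.ofReal_ne_zero.2 hcM.ne'
    rw [Complex.ofReal_sum, Finset.mul_sum]
    refine Finset.sum_congr rfl fun x _ => ?_
    simp only [hW]
    rw [Complex.ofReal_mul, Complex.ofReal_mul]
    field_simp
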